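/- Let $E$ be a real Fréchet space, i.e. a complete Hausdorff topological vector space whose topology is given by seminorms $\|\cdot\|_n$, $n\in\mathbb N$. Let $\{e_k\}_{k\in\mathbb N}$ be an unconditional Schauder basis of $E$: every $x\in E$ has a unique expansion $x=\sum_{k} x_ke_k$ with real coordinates $x_k$, convergent in $E$, and for every permutation $\pi$ of $\mathbb N$ the series $\sum_k x_{\pi(k)}e_{\pi(k)}$ also converges to $x$. Write $x\ll y$ if $x_k\le y_k$ for all $k$. A function $g:E\to\mathbb R$ is called left continuous if $g(u_n)\to g(x)$ whenever $u_n\to x$ in $E$ and $u_n\ll u_{n+1}$ for all $n$. A function $g$ from an interval $[0,s]$ (with Lebesgue measure) to $E$ is called integrable if there are step functions $g_n$ (finitely many values, each taken on a measurable set) such that $g_n\to g$ almost everywhere and $\int\|g_n-g_m\|_i\to0$ as $n,m\to\infty$ for every $i$; then $\int g:=\lim_n\int g_n$. Let $T>0$, $I_T=[0,T]$, $\hat x\in E$, and let $f=\sum_k f_ke_k:I_T\times E\to E$ satisfy: 1. for every $t\in I_T$ and every $k$ the function $x\mapsto f_k(t,x)$ is left continuous; 2. for every $x\in E$ the function $t\mapsto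 f(t,x)$ is integrable on $I_T$; 3. there is $C\in E$ with $f(t,x)\ll C$ for all $(t,x)\in I_T\times E$; 4. there is $x_*\in E$ with $x_*\ll\hat x+\int_0^tf(\xi,x_*)\,d\xi$ for all $t\in I_T$; 5. $f$ is monotone: for all $t\in I_T$ and $x,y\in E$, $x\ll y$ implies $f(t,x)\ll f(t,y)$. Then the initial value problem $\dot x=f(t,x)$, $x(0)=\hat x$ has a solution on $I_T$: there is a continuous function $x:I_T\to E$ such that $t\mapsto f(t,x(t))$ is integrable on $I_T$ and $$x(t)=\hat x+\int_0^tf(\xi,x(\xi))\,d\xi\qquad\text{for all }t\in I_T.$$ -/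

import Mathlib

open Filter Topology MeasureTheory Set

noncomputable section

/-- A sequence `e` is a Schauder basis if every `x` has exactly one expansion `x = ∑ cₖ eₖ`, the
series converging (as a sequence of partial sums) in the topology of `E`. Continuity of the
coordinates is not part of the definition. -/
def IsSchauderBasis {E : Type*} [AddCommGroup E] [Module ℝ E] [TopologicalSpace E]
    (e : ℕ → E) : Prop :=
  ∀ x : E, ∃! c : ℕ → ℝ,
    Tendsto (fun n : ℕ => ∑ k ∈ Finset.range n, c k • e k) atTop (𝓝 x)

namespace IsSchauderBasis

variable {E : Type*} [AddCommGroup E] [Module ℝ E] [TopologicalSpace E] {e : ℕ → E}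

/-- The `k`-th coordinate of `x` in the basis `e`. -/
def coord (he : IsSchauderBasis e) (x : E) (k : ℕ) : ℝ :=
  (he x).choose k

theorem tendsto_coord (he : IsSchauderBasis e) (x : E) :
    Tendsto (fun n : ℕ => ∑ k ∈ Finset.range n, he.coord x k • e k) atTop (𝓝 x) :=
  (he x).choose_spec.1

theorem coord_unique (he : IsSchauderBasis e) {x : E} {c : ℕ → ℝ}
    (hc : Tendsto (fun n : ℕ => ∑ k ∈ Finset.range n, c k • e k) atTop (𝓝 x)) :
    c = he.coord x :=
  (he x).choose_spec.2 c hc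

/-- The basis is unconditional: every rearrangement of the expansion of `x` converges to `x`. -/
def Unconditional (he : IsSchauderBasis e) : Prop :=
  ∀ (x : E) (π : Equiv.Perm ℕ),
    Tendsto (fun n : ℕ => ∑ k ∈ Finset.range n, he.coord x (π k) • e (π k)) atTop (𝓝 x)

/-- The coordinatewise order `x ≪ y`. -/
def CoordLE (he : IsSchauderBasis e) (x y : E) : Prop :=
  ∀ k : ℕ, he.coord x k ≤ he.coord y k

/-- `g : E → ℝ` is left continuous: `g (u n) → g x` whenever `u n → x` and
`u n ≪ u (n + 1)` for all `n`. -/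
def LeftContinuous (he : IsSchauderBasis e) (g : E → ℝ) : Prop :=
  ∀ (x : E) (u : ℕ → E), Tendsto u atTop (𝓝 x) → (∀ n : ℕ, he.CoordLE (u n) (u (n + 1))) →
    Tendsto (fun n : ℕ => g (u n)) atTop (𝓝 (g x))

end IsSchauderBasis

section Integral

variable {M E : Type*} [MeasurableSpace M] [AddCommGroup E] [Module ℝ E]

/-- The integral `∑ μ(s⁻¹(y)) y` of a step function: a function with finitely many values and
measurable fibres (the term `y = 0` contributes nothing). -/
def stepIntegral (μ : Measure M) (s : SimpleFunc M E) : E :=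
  ∑ y ∈ s.range, μ.real (s ⁻¹' {y}) • y

/-- `s` is an approximating sequence for `g`: step functions vanishing outside sets of finite
measure, Cauchy in `L¹` for every seminorm `p i`, and converging to `g` almost everywhere. -/
structure IsApproximating [TopologicalSpace E] (p : SeminormFamily ℝ E ℕ) (μ : Measure M)
    (s : ℕ → SimpleFunc M E) (g : M → E) : Prop where
  finite_support : ∀ n : ℕ, μ {x | s n x ≠ 0} < ⊤
  cauchy : ∀ (i : ℕ) (ε : ℝ), 0 < ε → ∃ l : ℕ, ∀ m n : ℕ, l < m → l < n →
    ∫⁻ x, ENNReal.ofReal (p i (s m x - s n x)) ∂μ < ENNReal.ofReal ε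
  ae_tendsto : ∀ᵐ x ∂μ, Tendsto (fun n : ℕ => s n x) atTop (𝓝 (g x))

/-- Lebesgue integrability of a function with values in a Fréchet space whose topology is given
by the seminorms `p`. -/
def FrechetIntegrable [TopologicalSpace E] (p : SeminormFamily ℝ E ℕ) (μ : Measure M)
    (g : M → E) : Prop :=
  ∃ s : ℕ → SimpleFunc M E, IsApproximating p μ s g

/-- `g` is integrable and `∫ g dμ = v`, i.e. `v` is the limit of the integrals of an approximating
sequence of `g`. -/
def HasFrechetIntegral [TopologicalSpace E] (p : SeminormFamily ℝ E ℕ) (μ : Measure M)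
    (g : M → E) (v : E) : Prop :=
  ∃ s : ℕ → SimpleFunc M E, IsApproximating p μ s g ∧
    Tendsto (fun n : ℕ => stepIntegral μ (s n)) atTop (𝓝 v)

end Integral

/-- `x` is a solution on `[0, T]` of `ẋ = f(t, x)`, `x(0) = x₀`: it is continuous, the function
`t ↦ f(t, x(t))` is integrable on `[0, T]`, and `x(t) = x₀ + ∫₀ᵗ f(ξ, x(ξ)) dξ` on `[0, T]`. -/
structure IsIVPSolution {E : Type*} [AddCommGroup E] [Module ℝ E] [TopologicalSpace E]
    (p : SeminormFamily ℝ E ℕ) (T : ℝ) (f : ℝ → E → E) (x₀ : E) (x : ℝ → E) : Prop where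
  continuousOn : ContinuousOn x (Icc 0 T)
  integrable : FrechetIntegrable p (volume.restrict (Icc 0 T)) (fun t => f t (x t))
  integral_eq : ∀ t ∈ Icc 0 T, ∃ v : E,
    HasFrechetIntegral p (volume.restrict (Icc 0 t)) (fun ξ => f ξ (x ξ)) v ∧ x t = x₀ + v

end

/-!
The solution is the limit of the monotone iteration `u₀ = x_*`, `uₙ₊₁(t) = x₀ + ∫₀ᵗ f(ξ, uₙ(ξ))
dξ`. Since `x_*` is a lower solution and `f` is monotone, the iterates increase; since `f` is
bounded above by `C`, their coordinates are bounded by those of one vector. Hence they converge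
coordinatewise, left continuity of `f` along the increasing sequence `uₙ(t)` gives convergence of
`f(t, uₙ(t))`, and the scalar dominated convergence theorem, coordinate by coordinate, turns the
recursion into the integral equation for the limit.

Three facts about an unconditional Schauder basis of a Fréchet space reduce the rest to
real-valued functions.

* Vectors whose coordinates are dominated by those of a fixed vector are as good as real
  sequences: every dominated sequence of numbers is a coordinate sequence (`exists_coord_eq`), and
  dominated coordinatewise convergence is convergence in `E` (`tendsto_of_coord`). Both follow
  from the uniform smallness of far-out finite sums (`exists_forall_finset_sum_lt`) and the fact
  that multipliers in `[-1, 1]` at most double a bound on finite sums (`seminorm_sum_smul_le`).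
* The coordinates, and the seminorms `supSeminorm (p i)` obtained by taking the supremum over all
  finite coordinate projections, are continuous (`continuous_coord`, `continuous_supSeminorm`).
  This is the open mapping theorem, proved here by Baire's theorem and successive approximation.
* Consequently a function on a finite measure space is integrable if and only if its coordinates
  are a.e. measurable and every `supSeminorm (p i)` of it has finite integral, and its integral is
  computed coordinatewise (`frechetIntegrable_of_coord`, `coord_integral`).

That `f(t, u(t))` has measurable coordinates uses left continuity a second time: `u` is the
pointwise limit of an increasing sequence of step functions (`exists_monotone_simpleFunc`).
-/

noncomputable section

/-! ### Rearrangements and tails of series -/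

/-- A subset `G` of `[a, b)` is the image of the initial segment of `[a, b)` of the same size under
a permutation that fixes everything outside `[a, b)`. -/
theorem exists_perm_image_Ico_eq {a b : ℕ} {G : Finset ℕ} (hG : G ⊆ Finset.Ico a b) :
    ∃ σ : Equiv.Perm ℕ, (∀ k, k ∉ Finset.Ico a b → σ k = k) ∧
      (Finset.Ico a (a + G.card)).image σ = G := by
  classical
  have hc : G.card ≤ b - a := by simpa using Finset.card_le_card hG
  let A := {x // x ∈ Finset.Ico a b}
  have hcard : Fintype.card {x : A // x.1 < a + G.card} = Fintype.card {x : A // x.1 ∈ G} := by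
    have h1 : Fintype.card {x : A // x.1 < a + G.card} = (Finset.Ico a (a + G.card)).card := by
      rw [← Fintype.card_coe (Finset.Ico a (a + G.card))]
      refine Fintype.card_congr ⟨fun x => ⟨x.1.1, ?_⟩, fun x => ⟨⟨x.1, ?_⟩, ?_⟩, ?_, ?_⟩
      · exact Finset.mem_Ico.2 ⟨(Finset.mem_Ico.1 x.1.2).1, x.2⟩
      · have := Finset.mem_Ico.1 x.2
        exact Finset.mem_Ico.2 ⟨this.1, by omega⟩
      · exact (Finset.mem_Ico.1 x.2).2
      · intro x; rfl
      · intro x; rfl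
    have h2 : Fintype.card {x : A // x.1 ∈ G} = G.card := by
      rw [← Fintype.card_coe G]
      exact Fintype.card_congr ⟨fun x => ⟨x.1.1, x.2⟩, fun x => ⟨⟨x.1, hG x.2⟩, x.2⟩,
        fun _ => rfl, fun _ => rfl⟩
    rw [h1, h2]; simp
  let ε : {x : A // x.1 < a + G.card} ≃ {x : A // x.1 ∈ G} := Fintype.equivOfCardEq hcard
  let τ : Equiv.Perm A := ε.extendSubtype
  refine ⟨Equiv.Perm.ofSubtype τ, fun k hk => Equiv.Perm.ofSubtype_apply_of_not_mem _ hk, ?_⟩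
  refine Finset.eq_of_subset_of_card_le ?_ ?_
  · intro y hy
    obtain ⟨x, hx, rfl⟩ := Finset.mem_image.1 hy
    have hx' := Finset.mem_Ico.1 hx
    have hxA : x ∈ Finset.Ico a b := Finset.mem_Ico.2 ⟨hx'.1, by omega⟩
    rw [Equiv.Perm.ofSubtype_apply_of_mem _ hxA]
    exact ε.extendSubtype_mem ⟨x, hxA⟩ hx'.2
  · rw [Finset.card_image_of_injective _ (Equiv.injective _)]; simp

/-- If all rearrangements of a series converge, then its finite sums far out are uniformly small.
Otherwise some disjoint blocks would carry finite sums that are not small, and a rearrangement that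
makes each of these sums consecutive would not be Cauchy. -/
theorem exists_forall_finset_sum_lt {E : Type*} [AddCommGroup E] [Module ℝ E] [TopologicalSpace E]
    [IsTopologicalAddGroup E] {v : ℕ → E}
    (hv : ∀ π : Equiv.Perm ℕ, ∃ x, Tendsto (fun n => ∑ k ∈ Finset.range n, v (π k)) atTop (𝓝 x))
    (p : Seminorm ℝ E) (hp : Continuous p) {ε : ℝ} (hε : 0 < ε) :
    ∃ N : ℕ, ∀ G : Finset ℕ, (∀ k ∈ G, N ≤ k) → p (∑ k ∈ G, v k) < ε := by
  classical
  by_contra! hcon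
  choose G hGN hGε using hcon
  -- the endpoints `m n` of consecutive blocks, the `n`-th of which contains `G (m n)`
  let m : ℕ → ℕ := fun n => Nat.rec 0 (fun _ a => max (a + 1) ((G a).sup id + 1)) n
  have hm : ∀ n, m (n + 1) = max (m n + 1) ((G (m n)).sup id + 1) := fun n => rfl
  have hmono : StrictMono m := strictMono_nat_of_lt_succ fun n => by rw [hm]; omega
  have hsub : ∀ n, G (m n) ⊆ Finset.Ico (m n) (m (n + 1)) := fun n k hk => by
    have h1 : k ≤ (G (m n)).sup id := Finset.le_sup (f := id) hk
    have h2 := hGN _ k hk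
    rw [Finset.mem_Ico, hm]; omega
  choose σ hσ hσG using fun n => exists_perm_image_Ico_eq (hsub n)
  have hblock : ∀ k, ∃ n, k ∈ Finset.Ico (m n) (m (n + 1)) := fun k => by
    have hex : ∃ n, k < m n := ⟨k + 1, hmono.le_apply (x := k + 1)⟩
    obtain ⟨j, hj⟩ : ∃ j, Nat.find hex = j + 1 :=
      Nat.exists_eq_succ_of_ne_zero fun h => by
        have := Nat.find_spec hex; rw [h] at this; exact absurd this (Nat.not_lt_zero _)
    refine ⟨j, Finset.mem_Ico.2 ⟨?_, ?_⟩⟩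
    · exact not_lt.1 (Nat.find_min hex (m := j) (by omega))
    · rw [← hj]; exact Nat.find_spec hex
  choose b hb using hblock
  have hbu : ∀ k n, k ∈ Finset.Ico (m n) (m (n + 1)) → b k = n := fun k n hk => by
    have h1 := Finset.mem_Ico.1 (hb k)
    have h2 := Finset.mem_Ico.1 hk
    have h3 := (hmono.lt_iff_lt (a := n) (b := b k + 1)).1 (h2.1.trans_lt h1.2)
    have h4 := (hmono.lt_iff_lt (a := b k) (b := n + 1)).1 (h1.1.trans_lt h2.2)
    omega
  have hσI : ∀ n k, k ∈ Finset.Ico (m n) (m (n + 1)) →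
      σ n k ∈ Finset.Ico (m n) (m (n + 1)) := fun n k hk => by
    by_contra h
    have h' := (σ n).injective (hσ n _ h)
    exact h (by rwa [h'])
  have hσI' : ∀ n k, k ∈ Finset.Ico (m n) (m (n + 1)) →
      (σ n).symm k ∈ Finset.Ico (m n) (m (n + 1)) := fun n k hk => by
    by_contra h
    have h' := hσ n _ h
    rw [Equiv.apply_symm_apply] at h'
    exact h (h' ▸ hk)
  let π : Equiv.Perm ℕ :=
    { toFun := fun k => σ (b k) k
      invFun := fun k => (σ (b k)).symm k
      left_inv := fun k => by
        have : b (σ (b k) k) = b k := hbu _ _ (hσI _ _ (hb k))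
        simp [this]
      right_inv := fun k => by
        have : b ((σ (b k)).symm k) = b k := hbu _ _ (hσI' _ _ (hb k))
        simp [this] }
  obtain ⟨x, hx⟩ := hv π
  have hcard : ∀ n, m n + (G (m n)).card ≤ m (n + 1) := fun n => by
    have := Finset.card_le_card (hsub n)
    have := hmono (Nat.lt_succ_self n)
    simp at *; omega
  have hdiff : ∀ n, ∑ k ∈ Finset.range (m n + (G (m n)).card), v (π k)
      - ∑ k ∈ Finset.range (m n), v (π k) = ∑ k ∈ G (m n), v k := fun n => by
    rw [← Finset.sum_Ico_eq_sub _ (Nat.le_add_right _ _)]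
    conv_rhs => rw [← hσG n]
    rw [Finset.sum_image fun _ _ _ _ h => (σ n).injective h]
    refine Finset.sum_congr rfl fun k hk => ?_
    have hk' := Finset.mem_Ico.1 hk
    have hbk : b k = n := hbu k n (Finset.mem_Ico.2 ⟨hk'.1, hk'.2.trans_le (hcard n)⟩)
    change v (σ (b k) k) = _
    rw [hbk]
  have ht : Tendsto (fun n => p (∑ k ∈ G (m n), v k)) atTop (𝓝 0) := by
    have h1 := (hx.comp (tendsto_atTop_mono (fun n => Nat.le_add_right (m n) (G (m n)).card)
      hmono.tendsto_atTop)).sub (hx.comp hmono.tendsto_atTop)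
    have h2 := (hp.tendsto _).comp h1
    rw [sub_self, map_zero] at h2
    refine h2.congr fun n => ?_
    simp only [Function.comp_apply, hdiff]
  obtain ⟨n, hn⟩ := (ht.eventually (gt_mem_nhds hε)).exists
  exact absurd hn (not_lt.2 (hGε _))

/-- As a function of multipliers in `[0, 1]` a seminorm is convex, hence bounded by its largest
value at the extreme points, which are the subsums. -/
theorem seminorm_sum_smul_le_of_mem_Icc {E : Type*} [AddCommGroup E] [Module ℝ E]
    (p : Seminorm ℝ E) (v : ℕ → E) (r : ℕ → ℝ) (hr : ∀ k, r k ∈ Icc (0 : ℝ) 1) (F : Finset ℕ)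
    (B : ℝ) (w : E) (hB : ∀ G ⊆ F, p (w + ∑ k ∈ G, v k) ≤ B) :
    p (w + ∑ k ∈ F, r k • v k) ≤ B := by
  classical
  induction F using Finset.induction_on generalizing w with
  | empty => simpa using hB ∅ (Finset.Subset.refl _)
  | insert a F ha ih =>
    have h1 := ih w fun G hG => hB G (hG.trans (Finset.subset_insert _ _))
    have h2 := ih (w + v a) fun G hG => by
      have := hB (insert a G) (Finset.insert_subset_insert _ hG)
      rwa [Finset.sum_insert fun h => ha (hG h), ← add_assoc] at this
    rw [Finset.sum_insert ha]
    have key : w + (r a • v a + ∑ k ∈ F, r k • v k)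
        = (1 - r a) • (w + ∑ k ∈ F, r k • v k) + r a • (w + v a + ∑ k ∈ F, r k • v k) := by
      module
    rw [key]
    have h3 := map_add_le_add p ((1 - r a) • (w + ∑ k ∈ F, r k • v k))
      (r a • (w + v a + ∑ k ∈ F, r k • v k))
    rw [map_smul_eq_mul, map_smul_eq_mul, Real.norm_of_nonneg (hr a).1,
      Real.norm_of_nonneg (sub_nonneg.2 (hr a).2)] at h3
    nlinarith [(hr a).1, (hr a).2]

/-- Multipliers in `[-1, 1]` increase the largest seminorm of a partial sum at most twofold: split
them into positive and negative parts. -/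
theorem seminorm_sum_smul_le {E : Type*} [AddCommGroup E] [Module ℝ E]
    (p : Seminorm ℝ E) (v : ℕ → E) (r : ℕ → ℝ) (hr : ∀ k, |r k| ≤ 1) (F : Finset ℕ)
    (B : ℝ) (hB : ∀ G ⊆ F, p (∑ k ∈ G, v k) ≤ B) :
    p (∑ k ∈ F, r k • v k) ≤ 2 * B := by
  have h1 := seminorm_sum_smul_le_of_mem_Icc p v (fun k => (r k)⁺)
    (fun k => ⟨posPart_nonneg _, by
      rw [posPart_def]; exact sup_le ((le_abs_self _).trans (hr k)) zero_le_one⟩) F B 0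
    (by simpa using hB)
  have h2 := seminorm_sum_smul_le_of_mem_Icc p v (fun k => (r k)⁻)
    (fun k => ⟨negPart_nonneg _, by
      rw [negPart_def]; exact sup_le ((neg_le_abs _).trans (hr k)) zero_le_one⟩) F B 0
    (by simpa using hB)
  have h3 : ∑ k ∈ F, r k • v k = ∑ k ∈ F, (r k)⁺ • v k - ∑ k ∈ F, (r k)⁻ • v k := by
    rw [← Finset.sum_sub_distrib]
    refine Finset.sum_congr rfl fun k _ => ?_
    rw [← sub_smul, posPart_sub_negPart]
  rw [zero_add] at h1 h2
  rw [h3]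
  linarith [map_sub_le_add p (∑ k ∈ F, (r k)⁺ • v k) (∑ k ∈ F, (r k)⁻ • v k)]

theorem seminorm_sum_smul_le_of_abs_le {E : Type*} [AddCommGroup E] [Module ℝ E]
    (p : Seminorm ℝ E) (e : ℕ → E) {c d : ℕ → ℝ} (hcd : ∀ k, |c k| ≤ |d k|) (F : Finset ℕ)
    (B : ℝ) (hB : ∀ G ⊆ F, p (∑ k ∈ G, d k • e k) ≤ B) :
    p (∑ k ∈ F, c k • e k) ≤ 2 * B := by
  have h := seminorm_sum_smul_le p (fun k => d k • e k) (fun k => c k / d k)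
    (fun k => by rw [abs_div]; exact div_le_one_of_le₀ (hcd k) (abs_nonneg _)) F B hB
  convert h using 3 with k
  rw [smul_smul]
  congr 1
  by_cases hd : d k = 0
  · have := hcd k
    rw [hd, abs_zero, abs_nonpos_iff] at this
    simp [this]
  · field_simp

/-! ### Coordinates and the unconditional seminorms -/

namespace IsSchauderBasis

section Algebraic

variable {E : Type*} [AddCommGroup E] [Module ℝ E] [TopologicalSpace E] {e : ℕ → E}

theorem coord_eq_of_tendsto (he : IsSchauderBasis e) {x : E} {c : ℕ → ℝ}
    (hc : Tendsto (fun n : ℕ => ∑ k ∈ Finset.range n, c k • e k) atTop (𝓝 x)) (k : ℕ) :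
    he.coord x k = c k := by
  rw [← he.coord_unique hc]

theorem coord_sum_smul (he : IsSchauderBasis e) (F : Finset ℕ) (c : ℕ → ℝ) (k : ℕ) :
    he.coord (∑ j ∈ F, c j • e j) k = if k ∈ F then c k else 0 := by
  refine he.coord_eq_of_tendsto (c := fun k => if k ∈ F then c k else 0) ?_ k
  obtain ⟨N, hN⟩ := F.exists_nat_subset_range
  refine tendsto_const_nhds.congr' ?_
  filter_upwards [eventually_ge_atTop N] with n hn
  rw [← Finset.sum_subset (hN.trans (Finset.range_subset_range.2 hn))]
  · exact Finset.sum_congr rfl fun k hk => by simp [hk]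
  · intro k _ hk; simp [hk]

theorem eq_of_coord_eq [T2Space E] (he : IsSchauderBasis e) {x y : E}
    (h : ∀ k, he.coord x k = he.coord y k) : x = y := by
  have hx := he.tendsto_coord x
  rw [show he.coord x = he.coord y from funext h] at hx
  exact tendsto_nhds_unique hx (he.tendsto_coord y)

theorem ne_zero [T2Space E] (he : IsSchauderBasis e) (k : ℕ) : e k ≠ 0 := by
  intro h
  have h1 := he.coord_sum_smul {k} (fun _ => 1) k
  have h2 := he.coord_sum_smul ∅ (fun _ => 1) k
  simp [h] at h1 h2
  rw [h2] at h1
  exact zero_ne_one h1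

variable [ContinuousAdd E] [ContinuousConstSMul ℝ E]

/-- The `k`-th coordinate as a linear functional. -/
def coordₗ (he : IsSchauderBasis e) (k : ℕ) : E →ₗ[ℝ] ℝ where
  toFun x := he.coord x k
  map_add' x y := he.coord_eq_of_tendsto (c := fun k => he.coord x k + he.coord y k) (by
    simpa only [add_smul, Finset.sum_add_distrib] using
      (he.tendsto_coord x).add (he.tendsto_coord y)) k
  map_smul' r x := he.coord_eq_of_tendsto (c := fun k => r * he.coord x k) (by
    simpa only [mul_smul, Finset.smul_sum] using (he.tendsto_coord x).const_smul r) k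

theorem coordₗ_apply (he : IsSchauderBasis e) (k : ℕ) (x : E) : he.coordₗ k x = he.coord x k := rfl

theorem coord_add (he : IsSchauderBasis e) (x y : E) (k : ℕ) :
    he.coord (x + y) k = he.coord x k + he.coord y k := map_add (he.coordₗ k) x y

theorem coord_sub (he : IsSchauderBasis e) (x y : E) (k : ℕ) :
    he.coord (x - y) k = he.coord x k - he.coord y k := map_sub (he.coordₗ k) x y

theorem coord_smul (he : IsSchauderBasis e) (r : ℝ) (x : E) (k : ℕ) :
    he.coord (r • x) k = r * he.coord x k := map_smul (he.coordₗ k) r x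

/-- The projection onto the span of the basis vectors with index in `F`. -/
def proj (he : IsSchauderBasis e) (F : Finset ℕ) : E →ₗ[ℝ] E :=
  ∑ k ∈ F, (he.coordₗ k).smulRight (e k)

theorem proj_apply (he : IsSchauderBasis e) (F : Finset ℕ) (x : E) :
    he.proj F x = ∑ k ∈ F, he.coord x k • e k := by
  simp [proj, coordₗ_apply]

/-- The supremum of `p` over all finite coordinate projections of `x`. For an unconditional basis
and a continuous `p` the supremum is finite, and up to the factor `2` it is monotone in the absolute
values of the coordinates. -/
def supSeminorm (he : IsSchauderBasis e) (p : Seminorm ℝ E) : Seminorm ℝ E :=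
  ⨆ F : Finset ℕ, p.comp (he.proj F)

end Algebraic

section Unconditional

variable {E : Type*} [AddCommGroup E] [Module ℝ E] [TopologicalSpace E] {e : ℕ → E}
  [IsTopologicalAddGroup E] {p : Seminorm ℝ E}

theorem Unconditional.exists_forall_sum_lt {he : IsSchauderBasis e} (hunc : he.Unconditional)
    (hp : Continuous p) (x : E) {ε : ℝ} (hε : 0 < ε) :
    ∃ N : ℕ, ∀ G : Finset ℕ, (∀ k ∈ G, N ≤ k) → p (∑ k ∈ G, he.coord x k • e k) < ε :=
  exists_forall_finset_sum_lt (v := fun k => he.coord x k • e k) (fun π => ⟨x, hunc x π⟩) p hp hε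

variable [ContinuousConstSMul ℝ E]

theorem Unconditional.bddAbove_proj {he : IsSchauderBasis e} (hunc : he.Unconditional)
    (hp : Continuous p) : BddAbove (range fun F : Finset ℕ => p.comp (he.proj F)) := by
  classical
  rw [Seminorm.bddAbove_range_iff]
  intro x
  obtain ⟨N, hN⟩ := hunc.exists_forall_sum_lt hp x one_pos
  refine ⟨∑ k ∈ Finset.range N, p (he.coord x k • e k) + 1, ?_⟩
  rintro _ ⟨F, rfl⟩
  simp only [Seminorm.comp_apply, proj_apply]
  rw [← Finset.sum_filter_add_sum_filter_not F (fun k => k < N)]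
  refine (map_add_le_add p _ _).trans (add_le_add ?_ ?_)
  · refine (Finset.le_sum_of_subadditive p (map_zero p).le (map_add_le_add p) _ _).trans ?_
    refine Finset.sum_le_sum_of_subset_of_nonneg (fun k hk => ?_) fun _ _ _ => apply_nonneg _ _
    exact Finset.mem_range.2 (Finset.mem_filter.1 hk).2
  · exact (hN _ fun k hk => not_lt.1 (Finset.mem_filter.1 hk).2).le

theorem Unconditional.seminorm_proj_le {he : IsSchauderBasis e} (hunc : he.Unconditional)
    (hp : Continuous p) (F : Finset ℕ) (x : E) : p (he.proj F x) ≤ he.supSeminorm p x := by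
  rw [supSeminorm, Seminorm.iSup_apply (hunc.bddAbove_proj hp)]
  exact le_ciSup (Seminorm.bddAbove_range_iff.1 (hunc.bddAbove_proj hp) x) F

theorem Unconditional.supSeminorm_le {he : IsSchauderBasis e} (hunc : he.Unconditional)
    (hp : Continuous p) {x : E} {B : ℝ} (h : ∀ F, p (he.proj F x) ≤ B) :
    he.supSeminorm p x ≤ B := by
  rw [supSeminorm, Seminorm.iSup_apply (hunc.bddAbove_proj hp)]
  exact ciSup_le h

theorem Unconditional.le_supSeminorm {he : IsSchauderBasis e} (hunc : he.Unconditional)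
    (hp : Continuous p) (x : E) : p x ≤ he.supSeminorm p x := by
  refine le_of_tendsto ((hp.tendsto x).comp (he.tendsto_coord x)) (Eventually.of_forall fun n => ?_)
  have := hunc.seminorm_proj_le hp (Finset.range n) x
  rwa [proj_apply] at this

theorem Unconditional.abs_coord_mul_le {he : IsSchauderBasis e} (hunc : he.Unconditional)
    (hp : Continuous p) (x : E) (k : ℕ) : |he.coord x k| * p (e k) ≤ he.supSeminorm p x := by
  have := hunc.seminorm_proj_le hp {k} x
  rwa [proj_apply, Finset.sum_singleton, map_smul_eq_mul, Real.norm_eq_abs] at this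

theorem Unconditional.supSeminorm_le_two_mul {he : IsSchauderBasis e} (hunc : he.Unconditional)
    (hp : Continuous p) {x y : E} (hxy : ∀ k, |he.coord x k| ≤ |he.coord y k|) :
    he.supSeminorm p x ≤ 2 * he.supSeminorm p y :=
  hunc.supSeminorm_le hp fun F => by
    rw [proj_apply]
    exact seminorm_sum_smul_le_of_abs_le p e hxy F _ fun G _ => by
      rw [← proj_apply]; exact hunc.seminorm_proj_le hp G y

end Unconditional

section Complete

variable {E : Type*} [AddCommGroup E] [Module ℝ E] [UniformSpace E] [IsUniformAddGroup E]
  {p : SeminormFamily ℝ E ℕ} {e : ℕ → E}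

/-- **Dominated convergence for coordinates**: if the coordinates of `u` converge to those of `x`
and are dominated by those of one vector `y`, then `u` converges to `x`. -/
theorem Unconditional.tendsto_of_coord {he : IsSchauderBasis e} (hunc : he.Unconditional)
    (hp : WithSeminorms p) {ι : Type*} {l : Filter ι} {u : ι → E} {x y : E}
    (hu : ∀ᶠ n in l, ∀ k, |he.coord (u n) k| ≤ |he.coord y k|)
    (hx : ∀ k, |he.coord x k| ≤ |he.coord y k|)
    (hlim : ∀ k, Tendsto (fun n => he.coord (u n) k) l (𝓝 (he.coord x k))) :
    Tendsto u l (𝓝 x) := by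
  classical
  have := hp.continuousSMul
  rw [hp.tendsto_nhds]
  intro i ε hε
  have hpi := hp.continuous_seminorm i
  obtain ⟨N, hN⟩ := hunc.exists_forall_sum_lt hpi y (ε := ε / 8) (by positivity)
  have hsum : Tendsto (fun n => ∑ k ∈ Finset.range N, |he.coord (u n - x) k| * p i (e k)) l
      (𝓝 0) := by
    rw [← Finset.sum_const_zero (s := Finset.range N)]
    refine tendsto_finsetSum _ fun k _ => ?_
    have h := ((hlim k).sub_const (he.coord x k)).abs.mul_const (p i (e k))
    simpa [coord_sub] using h
  filter_upwards [hu, hsum.eventually (gt_mem_nhds (show (0 : ℝ) < ε / 4 by positivity))]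
    with n hn hn2
  refine lt_of_le_of_lt (b := ε / 4 + ε / 2) ?_ (by linarith)
  refine le_of_tendsto ((hpi.tendsto _).comp (he.tendsto_coord (u n - x)))
    (eventually_atTop.2 ⟨N, fun m hm => ?_⟩)
  simp only [Function.comp_apply]
  rw [← Finset.sum_filter_add_sum_filter_not (Finset.range m) (fun k => k < N)]
  refine (map_add_le_add (p i) _ _).trans (add_le_add ?_ ?_)
  · refine (Finset.le_sum_of_subadditive (p i) (map_zero _).le (map_add_le_add _) _ _).trans
      (le_trans ?_ hn2.le)
    have : (Finset.range m).filter (fun k => k < N) = Finset.range N := by ext; simp; omega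
    rw [this]
    exact le_of_eq (Finset.sum_congr rfl fun k _ => by rw [map_smul_eq_mul, Real.norm_eq_abs])
  · have hd : ∀ k, |he.coord (u n - x) k| ≤ |2 * he.coord y k| := fun k => by
      rw [coord_sub, abs_mul, abs_two]
      linarith [abs_sub (he.coord (u n) k) (he.coord x k), hn k, hx k]
    have h := seminorm_sum_smul_le_of_abs_le (p i) e hd
      ((Finset.range m).filter fun k => ¬ k < N) (ε / 4) fun G hG => by
        have := hN G fun k hk => not_lt.1 (Finset.mem_filter.1 (hG hk)).2
        simp only [mul_smul, ← Finset.smul_sum]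
        rw [map_smul_eq_mul, Real.norm_eq_abs, abs_two]
        linarith
    linarith

/-- Every sequence of numbers dominated by the coordinates of a vector is the coordinate sequence of
a vector. -/
theorem Unconditional.exists_coord_eq [CompleteSpace E] {he : IsSchauderBasis e}
    (hunc : he.Unconditional) (hp : WithSeminorms p) {c : ℕ → ℝ} {y : E}
    (hc : ∀ k, |c k| ≤ |he.coord y k|) : ∃ x, ∀ k, he.coord x k = c k := by
  classical
  have := hp.continuousSMul
  have hcau : CauchySeq fun n => ∑ k ∈ Finset.range n, c k • e k := by
    rw [cauchySeq_iff_tendsto, uniformity_eq_comap_nhds_zero, tendsto_comap_iff,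
      hp.tendsto_nhds]
    intro i ε hε
    obtain ⟨N, hN⟩ := hunc.exists_forall_sum_lt (hp.continuous_seminorm i) y (ε := ε / 3)
      (by positivity)
    have key : ∀ a b, N ≤ a → a ≤ b →
        p i (∑ k ∈ Finset.range b, c k • e k - ∑ k ∈ Finset.range a, c k • e k) < ε := by
      intro a b ha hab
      rw [← Finset.sum_Ico_eq_sub _ hab]
      have := seminorm_sum_smul_le_of_abs_le (p i) e hc (Finset.Ico a b) (ε / 3) fun G hG =>
        (hN G fun k hk => ha.trans (Finset.mem_Ico.1 (hG hk)).1).le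
      linarith
    filter_upwards [eventually_ge_atTop (N, N)] with ⟨a, b⟩ hab
    simp only [Function.comp_apply, Prod.map, sub_zero]
    rcases le_total a b with h | h
    · exact key a b hab.1 h
    · rw [map_sub_rev]; exact key b a hab.2 h
  obtain ⟨x, hx⟩ := cauchySeq_tendsto_of_complete hcau
  exact ⟨x, he.coord_eq_of_tendsto hx⟩

end Complete

end IsSchauderBasis

/-! ### Continuity of the coordinates -/

open scoped Pointwise in
/-- In a Baire space the closure of an absorbing, convex and symmetric set is a neighbourhood
of `0`. -/
theorem closure_mem_nhds_zero_of_absorbing {E : Type*} [AddCommGroup E] [Module ℝ E]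
    [TopologicalSpace E] [IsTopologicalAddGroup E] [ContinuousSMul ℝ E] [BaireSpace E]
    {B : Set E} (hconv : Convex ℝ B) (hneg : ∀ x ∈ B, -x ∈ B)
    (habs : ∀ x, ∃ n : ℕ, x ∈ ((n : ℝ) + 1) • B) : closure B ∈ 𝓝 (0 : E) := by
  have hc : ∀ n : ℕ, ((n : ℝ) + 1) ≠ 0 := fun n => by positivity
  obtain ⟨n, z, hz⟩ := nonempty_interior_of_iUnion_of_closed
    (f := fun n : ℕ => ((n : ℝ) + 1) • closure B)
    (fun n => isClosed_closure.smul_of_ne_zero (hc n))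
    (eq_univ_of_forall fun x => by
      obtain ⟨n, hn⟩ := habs x
      exact mem_iUnion.2 ⟨n, smul_set_mono subset_closure hn⟩)
  rw [interior_smul₀ (hc n)] at hz
  obtain ⟨b, hb, rfl⟩ := hz
  have hb' : -b ∈ closure B := by
    have h := map_mem_closure continuous_neg (interior_subset hb) (t := B) fun x hx => hneg x hx
    exact h
  have h0 := hconv.closure.combo_interior_self_mem_interior hb hb'
    (show (0 : ℝ) < 1 / 2 by norm_num) (show (0 : ℝ) ≤ 1 / 2 by norm_num) (by norm_num)
  rw [smul_neg, add_neg_cancel] at h0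
  exact mem_interior_iff_mem_nhds.1 h0

namespace IsSchauderBasis

theorem exists_seminorm_pos {E : Type*} [AddCommGroup E] [Module ℝ E] [TopologicalSpace E]
    [T2Space E] {p : SeminormFamily ℝ E ℕ} {e : ℕ → E} (he : IsSchauderBasis e)
    (hp : WithSeminorms p) (k : ℕ) :
    ∃ l, 0 < p l (e k) := by
  obtain ⟨l, hl⟩ := hp.separating_of_T1 (e k) (he.ne_zero k)
  exact ⟨l, lt_of_le_of_ne (apply_nonneg _ _) (Ne.symm hl)⟩

variable {E : Type*} [AddCommGroup E] [Module ℝ E] [UniformSpace E] [IsUniformAddGroup E]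
  {p : SeminormFamily ℝ E ℕ} {e : ℕ → E}

/-- The closed ball of the finite supremum of the seminorms `supSeminorm (p l)`, `l ≤ n`, with
radius `2⁻ⁿ`. -/
def dyadicBall (he : IsSchauderBasis e) [ContinuousConstSMul ℝ E] (p : SeminormFamily ℝ E ℕ)
    (n : ℕ) : Set E :=
  ((Finset.range (n + 1)).sup fun l => he.supSeminorm (p l)).closedBall 0 ((1 / 2) ^ n)

theorem supSeminorm_le_of_mem_dyadicBall (he : IsSchauderBasis e) [ContinuousConstSMul ℝ E]
    {n l : ℕ} (hl : l ≤ n) {y : E} (hy : y ∈ he.dyadicBall p n) :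
    he.supSeminorm (p l) y ≤ (1 / 2) ^ n :=
  (Seminorm.le_def.1 (Finset.le_sup (f := fun l => he.supSeminorm (p l))
    (Finset.mem_range.2 (Nat.lt_succ_of_le hl))) y).trans (Seminorm.mem_closedBall_zero _ |>.1 hy)

theorem closure_dyadicBall_mem_nhds [CompleteSpace E] [ContinuousSMul ℝ E]
    (he : IsSchauderBasis e) (hp : WithSeminorms p) (n : ℕ) :
    closure (he.dyadicBall p n) ∈ 𝓝 (0 : E) := by
  have := hp.firstCountableTopology
  have : (uniformity E).IsCountablyGenerated := IsUniformAddGroup.uniformity_countably_generated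
  refine closure_mem_nhds_zero_of_absorbing (Seminorm.convex_closedBall _ _ _) (fun x hx => ?_)
    fun x => ?_
  · rw [dyadicBall, Seminorm.mem_closedBall_zero] at hx ⊢
    rwa [map_neg_eq_map]
  · set Q := (Finset.range (n + 1)).sup fun l => he.supSeminorm (p l) with hQ
    obtain ⟨m, hm⟩ := exists_nat_ge (Q x * 2 ^ n)
    have hm0 : (0 : ℝ) < (m : ℝ) + 1 := by positivity
    refine ⟨m, mem_smul_set.2 ⟨((m : ℝ) + 1)⁻¹ • x, ?_, smul_inv_smul₀ hm0.ne' x⟩⟩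
    rw [dyadicBall, Seminorm.mem_closedBall_zero, map_smul_eq_mul, ← hQ,
      Real.norm_of_nonneg (inv_nonneg.2 hm0.le), inv_mul_le_iff₀ hm0, one_div, inv_pow,
      ← div_eq_mul_inv, le_div_iff₀ (by positivity)]
    linarith

variable [T2Space E]

/-- The successive approximation step of the open mapping theorem: on the closure of `dyadicBall p i`
the seminorm `supSeminorm (p i)` is at most twice the radius. -/
theorem Unconditional.supSeminorm_le_of_mem_closure [CompleteSpace E] [ContinuousSMul ℝ E]
    {he : IsSchauderBasis e} (hunc : he.Unconditional) (hp : WithSeminorms p) {i : ℕ} {x : E}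
    (hx : x ∈ closure (he.dyadicBall p i)) : he.supSeminorm (p i) x ≤ 2 * (1 / 2) ^ i := by
  have hstep : ∀ (n : ℕ) (r : E), ∃ y, r ∈ closure (he.dyadicBall p n) →
      y ∈ he.dyadicBall p n ∧ r - y ∈ closure (he.dyadicBall p (n + 1)) := by
    intro n r
    by_cases hr : r ∈ closure (he.dyadicBall p n)
    · have hU : (fun y => r - y) ⁻¹' closure (he.dyadicBall p (n + 1)) ∈ 𝓝 r :=
        (continuous_const.sub continuous_id).continuousAt.preimage_mem_nhds
          (by simpa using he.closure_dyadicBall_mem_nhds hp (n + 1))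
      obtain ⟨y, hy1, hy2⟩ := mem_closure_iff_nhds.1 hr _ hU
      exact ⟨y, fun _ => ⟨hy2, hy1⟩⟩
    · exact ⟨0, fun h => absurd h hr⟩
  choose Y hY using hstep
  -- `R n` is the remainder after `n` steps, `u n` the sum of the first `n` approximants
  let R : ℕ → E := fun n => Nat.rec x (fun n r => r - Y (i + n) r) n
  have hR : ∀ n, R n ∈ closure (he.dyadicBall p (i + n)) := fun n => by
    induction n with
    | zero => exact hx
    | succ n ih => exact (hY _ _ ih).2
  have hpR : ∀ n l, l ≤ i + n → p l (R n) ≤ (1 / 2) ^ (i + n) := fun n l hl => by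
    have hcl : IsClosed {z | p l z ≤ (1 / 2) ^ (i + n)} :=
      isClosed_le (hp.continuous_seminorm l) continuous_const
    exact closure_minimal (fun z hz => (hunc.le_supSeminorm (hp.continuous_seminorm l) z).trans
      (he.supSeminorm_le_of_mem_dyadicBall hl hz)) hcl (hR n)
  let u : ℕ → E := fun n => x - R n
  have hu : ∀ n l, l ≤ i + n → ∀ d, he.supSeminorm (p l) (u (n + d) - u n)
      ≤ 2 * (1 / 2) ^ (i + n) - 2 * (1 / 2) ^ (i + n + d) := fun n l hl d => by
    induction d with
    | zero => simp
    | succ d ih =>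
      have h1 : u (n + (d + 1)) - u n = (u (n + d) - u n) + Y (i + (n + d)) (R (n + d)) := by
        change x - (R (n + d) - Y (i + (n + d)) (R (n + d))) - u n = x - R (n + d) - u n + _
        abel
      have h2 : he.supSeminorm (p l) (Y (i + (n + d)) (R (n + d))) ≤ (1 / 2) ^ (i + (n + d)) :=
        he.supSeminorm_le_of_mem_dyadicBall (by omega) (hY _ _ (hR (n + d))).1
      rw [h1]
      refine (map_add_le_add _ _ _).trans ((add_le_add ih h2).trans (le_of_eq ?_))
      rw [← add_assoc i n d, ← add_assoc (i + n) d 1, pow_succ]; ring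
  have hu' : ∀ n l, l ≤ i + n → ∀ d, he.supSeminorm (p l) (u (n + d) - u n)
      ≤ 2 * (1 / 2) ^ (i + n) := fun n l hl d => by
    have := hu n l hl d
    have : (0 : ℝ) ≤ 2 * (1 / 2) ^ (i + n + d) := by positivity
    linarith
  have hcoord : ∀ k, ∃ c, Tendsto (fun n => he.coord (u n) k) atTop (𝓝 c) := fun k => by
    obtain ⟨l, hl⟩ := he.exists_seminorm_pos hp k
    have hcau : CauchySeq fun n => he.coord (u (n + l)) k := by
      refine cauchySeq_of_le_geometric (1 / 2) (2 / p l (e k)) (by norm_num) fun n => ?_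
      have h1 := hunc.abs_coord_mul_le (hp.continuous_seminorm l) (u (n + l + 1) - u (n + l)) k
      have h2 := hu' (n + l) l (by omega) 1
      rw [dist_comm, Real.dist_eq, ← coord_sub, div_mul_eq_mul_div, le_div_iff₀ hl,
        show n + 1 + l = n + l + 1 by omega]
      refine (h1.trans h2).trans (mul_le_mul_of_nonneg_left ?_ two_pos.le)
      exact pow_le_pow_of_le_one (by norm_num) (by norm_num) (by omega)
    obtain ⟨c, hc⟩ := cauchySeq_tendsto_of_complete hcau
    exact ⟨c, (tendsto_add_atTop_iff_nat l).1 hc⟩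
  choose c hc using hcoord
  have hproj : ∀ (F : Finset ℕ) n l, l ≤ i + n →
      p l (∑ k ∈ F, c k • e k - he.proj F (u n)) ≤ 2 * (1 / 2) ^ (i + n) := fun F n l hl => by
    have h1 : Tendsto (fun d => p l (he.proj F (u (d + n)) - he.proj F (u n))) atTop
        (𝓝 (p l (∑ k ∈ F, c k • e k - he.proj F (u n)))) := by
      refine ((hp.continuous_seminorm l).tendsto _).comp (Tendsto.sub_const ?_ _)
      simp only [proj_apply]
      exact tendsto_finsetSum _ fun k _ =>
        (((tendsto_add_atTop_iff_nat n).2 (hc k)).smul_const (e k))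
    refine le_of_tendsto h1 (Eventually.of_forall fun d => ?_)
    rw [← map_sub, add_comm d n]
    exact (hunc.seminorm_proj_le (hp.continuous_seminorm l) F _).trans (hu' n l hl d)
  have hlim : Tendsto (fun N => ∑ k ∈ Finset.range N, c k • e k) atTop (𝓝 x) := by
    rw [hp.tendsto_nhds]
    intro l ε hε
    obtain ⟨n, hn⟩ := exists_pow_lt_of_lt_one (show 0 < ε / 8 by positivity)
      (show (1 / 2 : ℝ) < 1 by norm_num)
    have hn' : ((1 : ℝ) / 2) ^ (i + (n + l)) < ε / 8 :=
      lt_of_le_of_lt (pow_le_pow_of_le_one (by norm_num) (by norm_num) (by omega)) hn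
    have h3 := hpR (n + l) l (by omega)
    filter_upwards [(hp.tendsto_nhds _ _).1 (he.tendsto_coord (u (n + l))) l (ε / 4)
      (by positivity)] with N hN
    have h1 := hproj (Finset.range N) (n + l) l (by omega)
    rw [proj_apply] at h1
    set S := ∑ k ∈ Finset.range N, he.coord (u (n + l)) k • e k
    have h4 : ∑ k ∈ Finset.range N, c k • e k - x
        = (∑ k ∈ Finset.range N, c k • e k - S) + (S - u (n + l)) - R (n + l) := by
      change _ = _ + (S - (x - R (n + l))) - R (n + l)
      abel
    rw [h4]
    have h5 := map_sub_le_add (p l) ((∑ k ∈ Finset.range N, c k • e k - S) + (S - u (n + l)))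
      (R (n + l))
    have h6 := map_add_le_add (p l) (∑ k ∈ Finset.range N, c k • e k - S) (S - u (n + l))
    linarith
  refine hunc.supSeminorm_le (hp.continuous_seminorm i) fun F => ?_
  have h := hproj F 0 i (by omega)
  have hu0 : u 0 = 0 := sub_self x
  rw [hu0, map_zero, sub_zero, add_zero] at h
  rw [proj_apply, he.coord_unique hlim |>.symm]
  exact h

theorem Unconditional.continuous_supSeminorm [CompleteSpace E] {he : IsSchauderBasis e}
    (hunc : he.Unconditional) (hp : WithSeminorms p) [ContinuousSMul ℝ E] (i : ℕ) :
    Continuous (he.supSeminorm (p i)) := by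
  refine Seminorm.continuous' (r := 2 * (1 / 2) ^ i)
    (mem_of_superset (he.closure_dyadicBall_mem_nhds hp i) fun x hx => ?_)
  rw [Seminorm.mem_closedBall_zero]
  exact hunc.supSeminorm_le_of_mem_closure hp hx

theorem Unconditional.exists_abs_coord_le [CompleteSpace E] {he : IsSchauderBasis e}
    (hunc : he.Unconditional) (hp : WithSeminorms p) [ContinuousSMul ℝ E] (k : ℕ) :
    ∃ l A, ∀ x, |he.coord x k| ≤ A * he.supSeminorm (p l) x := by
  obtain ⟨l, hl⟩ := he.exists_seminorm_pos hp k
  refine ⟨l, (p l (e k))⁻¹, fun x => ?_⟩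
  rw [← div_eq_inv_mul, le_div_iff₀ hl]
  exact hunc.abs_coord_mul_le (hp.continuous_seminorm l) x k

theorem Unconditional.continuous_coord [CompleteSpace E] {he : IsSchauderBasis e}
    (hunc : he.Unconditional) (hp : WithSeminorms p) [ContinuousSMul ℝ E] (k : ℕ) :
    Continuous fun x => he.coord x k := by
  obtain ⟨l, A, hA⟩ := hunc.exists_abs_coord_le hp k
  refine continuous_iff_continuousAt.2 fun x => ?_
  rw [ContinuousAt, tendsto_iff_dist_tendsto_zero]
  have h : Tendsto (fun y => A * he.supSeminorm (p l) (y - x)) (𝓝 x) (𝓝 0) := by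
    have h1 : Continuous fun y => A * he.supSeminorm (p l) (y - x) :=
      continuous_const.mul ((hunc.continuous_supSeminorm hp l).comp (continuous_sub_right x))
    simpa using h1.tendsto x
  refine squeeze_zero (fun _ => dist_nonneg) (fun y => ?_) h
  rw [Real.dist_eq, ← coord_sub]
  exact hA _

end IsSchauderBasis

/-! ### Integrals of step functions -/

theorem measurable_comp_simpleFunc {M E β : Type*} [MeasurableSpace M] [MeasurableSpace β]
    (s : SimpleFunc M E) (g : E → β) : Measurable fun t => g (s t) :=
  (s.map g).measurable

section StepIntegral

variable {M E : Type*} [MeasurableSpace M] [AddCommGroup E] [Module ℝ E] {μ : Measure M}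

theorem map_stepIntegral [IsFiniteMeasure μ] (φ : E →ₗ[ℝ] ℝ) (s : SimpleFunc M E) :
    φ (stepIntegral μ s) = ∫ t, φ (s t) ∂μ := by
  classical
  have h : ∀ t, φ (s t) = ∑ y ∈ s.range, (s ⁻¹' {y}).indicator (fun _ => φ y) t := fun t => by
    rw [Finset.sum_eq_single (s t)]
    · simp
    · intro y _ hy
      exact indicator_of_notMem (fun h => hy h.symm) _
    · intro h; exact absurd (s.mem_range_self t) h
  simp only [h]
  rw [integral_finsetSum _ fun y _ =>
    (integrable_const (φ y)).indicator (s.measurableSet_fiber y)]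
  simp only [stepIntegral, map_sum, map_smul]
  exact Finset.sum_congr rfl fun y _ => by
    rw [integral_indicator_const _ (s.measurableSet_fiber y)]

theorem seminorm_stepIntegral_le [IsFiniteMeasure μ] (P : Seminorm ℝ E) (s : SimpleFunc M E) :
    ENNReal.ofReal (P (stepIntegral μ s)) ≤ ∫⁻ t, ENNReal.ofReal (P (s t)) ∂μ := by
  have h : ∫⁻ t, ENNReal.ofReal (P (s t)) ∂μ
      = ∑ y ∈ s.range, ENNReal.ofReal (P y) * μ (s ⁻¹' {y}) := by
    rw [← SimpleFunc.map_lintegral (fun y => ENNReal.ofReal (P y)) s,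
      ← SimpleFunc.lintegral_eq_lintegral]
    rfl
  rw [h]
  calc ENNReal.ofReal (P (stepIntegral μ s))
      ≤ ENNReal.ofReal (∑ y ∈ s.range, P (μ.real (s ⁻¹' {y}) • y)) :=
        ENNReal.ofReal_le_ofReal
          (Finset.le_sum_of_subadditive P (map_zero P).le (map_add_le_add P) _ _)
    _ = _ := by
        rw [ENNReal.ofReal_sum_of_nonneg fun _ _ => apply_nonneg _ _]
        refine Finset.sum_congr rfl fun y _ => ?_
        rw [map_smul_eq_mul, mul_comm, ENNReal.ofReal_mul (apply_nonneg _ _),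
          Real.norm_of_nonneg measureReal_nonneg, ofReal_measureReal]

theorem IsApproximating.mono [TopologicalSpace E] {p : SeminormFamily ℝ E ℕ} {ν : Measure M}
    {s : ℕ → SimpleFunc M E} {g : M → E} (h : IsApproximating p μ s g) (hν : ν ≤ μ) :
    IsApproximating p ν s g where
  finite_support n := (hν _).trans_lt (h.finite_support n)
  cauchy i ε hε := by
    obtain ⟨l, hl⟩ := h.cauchy i ε hε
    exact ⟨l, fun m n hm hn => (lintegral_mono' hν le_rfl).trans_lt (hl m n hm hn)⟩
  ae_tendsto := ae_mono hν h.ae_tendsto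

/-- Approximating sequences converge in `L¹` for every continuous seminorm. -/
theorem IsApproximating.tendsto_lintegral [TopologicalSpace E] [IsTopologicalAddGroup E]
    {p : SeminormFamily ℝ E ℕ} (hp : WithSeminorms p) {s : ℕ → SimpleFunc M E} {g : M → E}
    (h : IsApproximating p μ s g) {Q : Seminorm ℝ E} (hQ : Continuous Q) :
    Tendsto (fun m => ∫⁻ t, ENNReal.ofReal (Q (s m t - g t)) ∂μ) atTop (𝓝 0) := by
  obtain ⟨S, A, -, hA⟩ := Seminorm.bound_of_continuous hp Q hQ
  have hQle : ∀ x, Q x ≤ A * ∑ i ∈ S, p i x := fun x => by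
    have h1 := Seminorm.le_def.1 hA x
    have h2 : S.sup p x ≤ ∑ i ∈ S, p i x :=
      Seminorm.finset_sup_apply_le (Finset.sum_nonneg fun _ _ => apply_nonneg _ _) fun i hi =>
        Finset.single_le_sum (f := fun i => p i x) (fun _ _ => apply_nonneg _ _) hi
    refine h1.trans ?_
    exact mul_le_mul_of_nonneg_left h2 A.coe_nonneg
  rw [ENNReal.tendsto_atTop_zero]
  intro ε hε
  -- the same smallness for each of the finitely many seminorms that dominate `Q`
  obtain ⟨δ, hδ, hδε⟩ : ∃ δ : ℝ, 0 < δ ∧ (A : ENNReal) * (S.card * ENNReal.ofReal δ) ≤ ε := by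
    by_cases hε' : ε = ⊤
    · exact ⟨1, one_pos, by simp [hε']⟩
    · have hr : 0 < ε.toReal := ENNReal.toReal_pos hε.ne' hε'
      have hd : (0 : ℝ) < A * S.card + 1 := by positivity
      refine ⟨ε.toReal / (A * S.card + 1), by positivity, ?_⟩
      rw [← ENNReal.ofReal_natCast, ← ENNReal.ofReal_coe_nnreal,
        ← ENNReal.ofReal_mul (by positivity), ← ENNReal.ofReal_mul (by positivity)]
      refine ENNReal.ofReal_le_of_le_toReal ?_
      rw [← mul_assoc, mul_div_assoc', div_le_iff₀ hd]
      nlinarith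
  choose l hl using fun i => h.cauchy i δ hδ
  refine ⟨S.sup l + 1, fun m hm => ?_⟩
  have hmn : ∀ n, S.sup l < n → ∫⁻ t, ENNReal.ofReal (Q (s m t - s n t)) ∂μ ≤ ε := fun n hn => by
    calc ∫⁻ t, ENNReal.ofReal (Q (s m t - s n t)) ∂μ
        ≤ ∫⁻ t, A * ∑ i ∈ S, ENNReal.ofReal (p i (s m t - s n t)) ∂μ := by
          refine lintegral_mono fun t => ?_
          rw [← ENNReal.ofReal_coe_nnreal, ← ENNReal.ofReal_sum_of_nonneg fun _ _ =>
            apply_nonneg _ _, ← ENNReal.ofReal_mul A.coe_nonneg]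
          exact ENNReal.ofReal_le_ofReal (hQle _)
      _ = A * ∑ i ∈ S, ∫⁻ t, ENNReal.ofReal (p i (s m t - s n t)) ∂μ := by
          have hmeas : ∀ i, Measurable fun t => ENNReal.ofReal (p i (s m t - s n t)) := fun i =>
            measurable_comp_simpleFunc (s m - s n) fun x => ENNReal.ofReal (p i x)
          rw [lintegral_const_mul _ (Finset.measurable_fun_sum _ fun i _ => hmeas i),
            lintegral_finsetSum _ fun i _ => hmeas i]
      _ ≤ A * ∑ i ∈ S, ENNReal.ofReal δ := by
          gcongr with i hi
          have := Finset.le_sup (f := l) hi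
          exact (hl i m n (by omega) (by omega)).le
      _ ≤ ε := by simpa using hδε
  calc ∫⁻ t, ENNReal.ofReal (Q (s m t - g t)) ∂μ
      ≤ ∫⁻ t, liminf (fun n => ENNReal.ofReal (Q (s m t - s n t))) atTop ∂μ := by
        refine lintegral_mono_ae ?_
        filter_upwards [h.ae_tendsto] with t ht
        have h1 : Tendsto (fun n => ENNReal.ofReal (Q (s m t - s n t))) atTop
            (𝓝 (ENNReal.ofReal (Q (s m t - g t)))) :=
          ENNReal.tendsto_ofReal ((hQ.tendsto _).comp (ht.const_sub (s m t)))
        exact h1.liminf_eq.ge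
    _ ≤ liminf (fun n => ∫⁻ t, ENNReal.ofReal (Q (s m t - s n t)) ∂μ) atTop :=
        lintegral_liminf_le fun n =>
          measurable_comp_simpleFunc (s m - s n) fun x => ENNReal.ofReal (Q x)
    _ ≤ ε := by
        refine liminf_le_of_le (by isBoundedDefault) fun b hb => ?_
        obtain ⟨n, hn, hn'⟩ := (hb.and (eventually_gt_atTop (S.sup l))).exists
        exact hn.trans (hmn n hn')

theorem IsApproximating.lintegral_lt_top [TopologicalSpace E] [IsTopologicalAddGroup E]
    [IsFiniteMeasure μ]
    {p : SeminormFamily ℝ E ℕ} (hp : WithSeminorms p) {s : ℕ → SimpleFunc M E} {g : M → E}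
    (h : IsApproximating p μ s g) {Q : Seminorm ℝ E} (hQ : Continuous Q) :
    ∫⁻ t, ENNReal.ofReal (Q (g t)) ∂μ < ⊤ := by
  obtain ⟨m, hm⟩ := ((h.tendsto_lintegral hp hQ).eventually (gt_mem_nhds one_pos)).exists
  have hs : ∫⁻ t, ENNReal.ofReal (Q (s m t)) ∂μ < ⊤ := by
    have h1 : ∫⁻ t, ENNReal.ofReal (Q (s m t)) ∂μ
        = ((s m).map fun y => ENNReal.ofReal (Q y)).lintegral μ := by
      rw [← SimpleFunc.lintegral_eq_lintegral]; rfl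
    rw [h1, SimpleFunc.map_lintegral]
    exact ENNReal.sum_lt_top.2 fun y _ =>
      ENNReal.mul_lt_top ENNReal.ofReal_lt_top (measure_lt_top _ _)
  calc ∫⁻ t, ENNReal.ofReal (Q (g t)) ∂μ
      ≤ ∫⁻ t, ENNReal.ofReal (Q (s m t)) + ENNReal.ofReal (Q (s m t - g t)) ∂μ := by
        refine lintegral_mono fun t => ?_
        rw [← ENNReal.ofReal_add (apply_nonneg _ _) (apply_nonneg _ _)]
        refine ENNReal.ofReal_le_ofReal ?_
        have := map_sub_le_add Q (s m t) (s m t - g t)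
        rwa [sub_sub_cancel] at this
    _ = ∫⁻ t, ENNReal.ofReal (Q (s m t)) ∂μ + ∫⁻ t, ENNReal.ofReal (Q (s m t - g t)) ∂μ :=
        lintegral_add_left (measurable_comp_simpleFunc (s m) fun x => ENNReal.ofReal (Q x)) _
    _ < ⊤ := ENNReal.add_lt_top.2 ⟨hs, hm.trans ENNReal.one_lt_top⟩

end StepIntegral

/-! ### Integrability in terms of coordinates -/

namespace IsSchauderBasis

variable {M E : Type*} [MeasurableSpace M] {μ : Measure M} [AddCommGroup E] [Module ℝ E]
  [UniformSpace E] [IsUniformAddGroup E] {p : SeminormFamily ℝ E ℕ} {e : ℕ → E}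

/-- The finite sum `∑ k < n, φ k • e k` of real step functions as a step function. -/
def simpleSum (e : ℕ → E) (φ : ℕ → SimpleFunc M ℝ) (n : ℕ) : SimpleFunc M E :=
  ∑ k ∈ Finset.range n, (φ k).map fun r => r • e k

omit [UniformSpace E] [IsUniformAddGroup E] in
theorem simpleSum_apply (e : ℕ → E) (φ : ℕ → SimpleFunc M ℝ) (n : ℕ) (t : M) :
    simpleSum e φ n t = ∑ k ∈ Finset.range n, φ k t • e k := by
  induction n with
  | zero => simp [simpleSum]
  | succ n ih =>
    rw [Finset.sum_range_succ, ← ih, simpleSum, Finset.sum_range_succ]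
    rfl

section Necessary

variable [T2Space E] [CompleteSpace E] [ContinuousSMul ℝ E]

theorem Unconditional.aemeasurable_coord {he : IsSchauderBasis e} (hunc : he.Unconditional)
    (hp : WithSeminorms p) {g : M → E} (hg : FrechetIntegrable p μ g) (k : ℕ) :
    AEMeasurable (fun t => he.coord (g t) k) μ := by
  obtain ⟨s, hs⟩ := hg
  refine aemeasurable_of_tendsto_metrizable_ae atTop
    (fun n => (measurable_comp_simpleFunc (s n) fun x => he.coord x k).aemeasurable) ?_
  filter_upwards [hs.ae_tendsto] with t ht
  exact ((hunc.continuous_coord hp k).tendsto _).comp ht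

theorem Unconditional.lintegral_supSeminorm_lt_top [IsFiniteMeasure μ] {he : IsSchauderBasis e}
    (hunc : he.Unconditional) (hp : WithSeminorms p) {g : M → E} (hg : FrechetIntegrable p μ g)
    (i : ℕ) : ∫⁻ t, ENNReal.ofReal (he.supSeminorm (p i) (g t)) ∂μ < ⊤ := by
  obtain ⟨s, hs⟩ := hg
  exact hs.lintegral_lt_top hp (hunc.continuous_supSeminorm hp i)

theorem Unconditional.integrable_coord [IsFiniteMeasure μ] {he : IsSchauderBasis e}
    (hunc : he.Unconditional) (hp : WithSeminorms p) {g : M → E} (hg : FrechetIntegrable p μ g)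
    (k : ℕ) : Integrable (fun t => he.coord (g t) k) μ := by
  refine ⟨(hunc.aemeasurable_coord hp hg k).aestronglyMeasurable, ?_⟩
  obtain ⟨l, A, hA⟩ := hunc.exists_abs_coord_le hp k
  calc ∫⁻ t, ‖he.coord (g t) k‖ₑ ∂μ
      ≤ ∫⁻ t, ENNReal.ofReal |A| * ENNReal.ofReal (he.supSeminorm (p l) (g t)) ∂μ := by
        refine lintegral_mono fun t => ?_
        rw [Real.enorm_eq_ofReal_abs, ← ENNReal.ofReal_mul (abs_nonneg _)]
        exact ENNReal.ofReal_le_ofReal ((hA _).trans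
          (mul_le_mul_of_nonneg_right (le_abs_self A) (apply_nonneg _ _)))
    _ = ENNReal.ofReal |A| * ∫⁻ t, ENNReal.ofReal (he.supSeminorm (p l) (g t)) ∂μ :=
        lintegral_const_mul' _ _ ENNReal.ofReal_ne_top
    _ < ⊤ := ENNReal.mul_lt_top ENNReal.ofReal_lt_top (hunc.lintegral_supSeminorm_lt_top hp hg l)

theorem Unconditional.coord_integral [IsFiniteMeasure μ] {he : IsSchauderBasis e}
    (hunc : he.Unconditional) (hp : WithSeminorms p) {g : M → E} {v : E}
    (hg : HasFrechetIntegral p μ g v) (k : ℕ) : he.coord v k = ∫ t, he.coord (g t) k ∂μ := by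
  obtain ⟨s, hs, hv⟩ := hg
  obtain ⟨l, A, hA⟩ := hunc.exists_abs_coord_le hp k
  have h1 : Tendsto (fun n => ∫ t, he.coord (s n t) k ∂μ) atTop (𝓝 (he.coord v k)) := by
    refine (((hunc.continuous_coord hp k).tendsto _).comp hv).congr fun n => ?_
    exact map_stepIntegral (he.coordₗ k) (s n)
  refine tendsto_nhds_unique h1 (tendsto_integral_of_L1 _
    (hunc.integrable_coord hp ⟨s, hs⟩ k).aestronglyMeasurable
    (Eventually.of_forall fun n => ((s n).map fun x => he.coord x k).integrable_of_isFiniteMeasure)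
    ?_)
  have h2 := ENNReal.Tendsto.const_mul (a := ENNReal.ofReal |A|)
    (hs.tendsto_lintegral hp (hunc.continuous_supSeminorm hp l)) (Or.inr ENNReal.ofReal_ne_top)
  rw [mul_zero] at h2
  refine tendsto_of_tendsto_of_tendsto_of_le_of_le tendsto_const_nhds h2
    (fun _ => zero_le) fun n => ?_
  rw [← lintegral_const_mul' _ _ ENNReal.ofReal_ne_top]
  refine lintegral_mono fun t => ?_
  rw [Real.enorm_eq_ofReal_abs, ← ENNReal.ofReal_mul (abs_nonneg _)]
  change ENNReal.ofReal |he.coord (s n t) k - he.coord (g t) k| ≤ _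
  rw [← coord_sub]
  exact ENNReal.ofReal_le_ofReal ((hA _).trans
    (mul_le_mul_of_nonneg_right (le_abs_self A) (apply_nonneg _ _)))

theorem exists_hasFrechetIntegral [IsFiniteMeasure μ] (he : IsSchauderBasis e)
    (hp : WithSeminorms p) {g : M → E} (hg : FrechetIntegrable p μ g) :
    ∃ v, HasFrechetIntegral p μ g v := by
  obtain ⟨s, hs⟩ := hg
  have hsub : ∀ m n, stepIntegral μ (s m) - stepIntegral μ (s n) = stepIntegral μ (s m - s n) := by
    intro m n
    refine he.eq_of_coord_eq fun k => ?_
    rw [coord_sub]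
    simp only [← coordₗ_apply, map_stepIntegral]
    rw [← integral_sub]
    · exact integral_congr_ae (Eventually.of_forall fun t => by simp)
    · exact ((s m).map (he.coordₗ k)).integrable_of_isFiniteMeasure
    · exact ((s n).map (he.coordₗ k)).integrable_of_isFiniteMeasure
  have hcau : CauchySeq fun n => stepIntegral μ (s n) := by
    rw [cauchySeq_iff_tendsto, uniformity_eq_comap_nhds_zero, tendsto_comap_iff,
      hp.tendsto_nhds]
    intro i ε hε
    obtain ⟨l, hl⟩ := hs.cauchy i ε hε
    filter_upwards [eventually_ge_atTop (l + 1, l + 1)] with ⟨a, b⟩ hab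
    simp only [Function.comp_apply, Prod.map, sub_zero]
    rw [hsub]
    have h1 : l < b := hab.2
    have h2 : l < a := hab.1
    exact (ENNReal.ofReal_lt_ofReal_iff hε).1
      ((seminorm_stepIntegral_le (p i) _).trans_lt (hl b a h1 h2))
  obtain ⟨v, hv⟩ := cauchySeq_tendsto_of_complete hcau
  exact ⟨v, s, hs, hv⟩

end Necessary

/-- A function with measurable coordinates is integrable as soon as all seminorms
`supSeminorm (p i)` of it are: truncate the expansion and replace the coordinates by step functions
that they dominate. -/
theorem Unconditional.frechetIntegrable_of_coord [IsFiniteMeasure μ] [ContinuousSMul ℝ E]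
    {he : IsSchauderBasis e} (hunc : he.Unconditional) (hp : WithSeminorms p) {g : M → E}
    (hmeas : ∀ k, AEMeasurable (fun t => he.coord (g t) k) μ)
    (hfin : ∀ i, ∫⁻ t, ENNReal.ofReal (he.supSeminorm (p i) (g t)) ∂μ < ⊤) :
    FrechetIntegrable p μ g := by
  let ψ : ℕ → M → ℝ := fun k => (hmeas k).mk _
  let φ : ℕ → ℕ → SimpleFunc M ℝ := fun n k =>
    SimpleFunc.approxOn (ψ k) (hmeas k).measurable_mk univ 0 (mem_univ _) n
  let s : ℕ → SimpleFunc M E := fun n => simpleSum e (φ n) n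
  have hcoord : ∀ n t k, he.coord (s n t) k = if k ∈ Finset.range n then φ n k t else 0 :=
    fun n t k => by
      rw [simpleSum_apply]; exact he.coord_sum_smul _ (fun k => φ n k t) k
  have hae : ∀ᵐ t ∂μ, ∀ k, he.coord (g t) k = ψ k t :=
    ae_all_iff.2 fun k => (hmeas k).ae_eq_mk
  have hdom : ∀ t, (∀ k, he.coord (g t) k = ψ k t) →
      ∀ n k, |he.coord (s n t) k| ≤ |he.coord ((2 : ℝ) • g t) k| := fun t ht n k => by
    rw [hcoord, coord_smul, ht, abs_mul, abs_two, two_mul]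
    split_ifs
    · exact SimpleFunc.norm_approxOn_zero_le (hmeas k).measurable_mk (mem_univ _) t n
    · rw [abs_zero]; positivity
  have hlim : ∀ t, (∀ k, he.coord (g t) k = ψ k t) → Tendsto (fun n => s n t) atTop (𝓝 (g t)) :=
    fun t ht => by
      refine hunc.tendsto_of_coord hp (y := (2 : ℝ) • g t)
        (Eventually.of_forall fun n => hdom t ht n) (fun k => ?_) fun k => ?_
      · rw [coord_smul, abs_mul, abs_two]; linarith [abs_nonneg (he.coord (g t) k)]
      · rw [ht]
        refine (SimpleFunc.tendsto_approxOn (hmeas k).measurable_mk (mem_univ (0 : ℝ))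
          (x := t) (by simp)).congr' ?_
        filter_upwards [eventually_gt_atTop k] with n hn
        rw [hcoord, if_pos (Finset.mem_range.2 hn)]
  have hq : ∀ t, (∀ k, he.coord (g t) k = ψ k t) → ∀ i n,
      p i (s n t) ≤ 4 * he.supSeminorm (p i) (g t) := fun t ht i n => by
    have hpi := hp.continuous_seminorm i
    have h1 := hunc.supSeminorm_le_two_mul hpi (hdom t ht n)
    rw [map_smul_eq_mul, Real.norm_eq_abs, abs_two] at h1
    linarith [hunc.le_supSeminorm hpi (s n t)]
  refine ⟨s, fun n => measure_lt_top _ _, fun i ε hε => ?_, ?_⟩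
  · have hpi := hp.continuous_seminorm i
    have ht : Tendsto (fun mn : ℕ × ℕ => ∫⁻ t, ENNReal.ofReal (p i (s mn.1 t - s mn.2 t)) ∂μ)
        (atTop ×ˢ atTop) (𝓝 (∫⁻ _, 0 ∂μ)) := by
      refine tendsto_lintegral_filter_of_dominated_convergence
        (fun t => ENNReal.ofReal 8 * ENNReal.ofReal (he.supSeminorm (p i) (g t)))
        (Eventually.of_forall fun mn => measurable_comp_simpleFunc (s mn.1 - s mn.2)
          fun x => ENNReal.ofReal (p i x)) (Eventually.of_forall fun mn => ?_) ?_ ?_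
      · filter_upwards [hae] with t ht
        rw [← ENNReal.ofReal_mul (by norm_num)]
        refine ENNReal.ofReal_le_ofReal ?_
        linarith [map_sub_le_add (p i) (s mn.1 t) (s mn.2 t), hq t ht i mn.1, hq t ht i mn.2]
      · rw [lintegral_const_mul' _ _ ENNReal.ofReal_ne_top]
        exact (ENNReal.mul_lt_top ENNReal.ofReal_lt_top (hfin i)).ne
      · filter_upwards [hae] with t ht
        have h1 := ((hlim t ht).comp (tendsto_fst (f := atTop) (g := (atTop : Filter ℕ)))).sub
          ((hlim t ht).comp (tendsto_snd (f := (atTop : Filter ℕ)) (g := atTop)))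
        have h2 := ENNReal.tendsto_ofReal ((hpi.tendsto _).comp h1)
        rw [sub_self, map_zero, ENNReal.ofReal_zero] at h2
        exact h2
    rw [lintegral_zero, prod_atTop_atTop_eq] at ht
    obtain ⟨⟨a, b⟩, hab⟩ := eventually_atTop.1
      (ht.eventually (gt_mem_nhds (ENNReal.ofReal_pos.2 hε)))
    refine ⟨max a b, fun m n hm hn => hab (m, n) ⟨?_, ?_⟩⟩
    · exact (le_max_left a b).trans hm.le
    · exact (le_max_right a b).trans hn.le
  · filter_upwards [hae] with t ht
    exact hlim t ht

theorem Unconditional.exists_coord_eq_abs_add_abs [CompleteSpace E] {he : IsSchauderBasis e}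
    (hunc : he.Unconditional) (hp : WithSeminorms p) (y z : E) :
    ∃ x, ∀ k, he.coord x k = |he.coord y k| + |he.coord z k| := by
  have := hp.continuousSMul
  obtain ⟨y', hy⟩ := hunc.exists_coord_eq hp (c := fun k => |he.coord y k|) (y := y)
    fun k => (abs_abs _).le
  obtain ⟨z', hz⟩ := hunc.exists_coord_eq hp (c := fun k => |he.coord z k|) (y := z)
    fun k => (abs_abs _).le
  exact ⟨y' + z', fun k => by rw [coord_add, hy, hz]⟩

theorem Unconditional.supSeminorm_le_of_abs_le_add [CompleteSpace E] [ContinuousSMul ℝ E]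
    {he : IsSchauderBasis e} (hunc : he.Unconditional) (hp : WithSeminorms p) (i : ℕ) {x y z : E}
    (h : ∀ k, |he.coord x k| ≤ |he.coord y k| + |he.coord z k|) :
    he.supSeminorm (p i) x ≤ 4 * (he.supSeminorm (p i) y + he.supSeminorm (p i) z) := by
  have hpi := hp.continuous_seminorm i
  obtain ⟨y', hy⟩ := hunc.exists_coord_eq hp (c := fun k => |he.coord y k|) (y := y)
    fun k => (abs_abs _).le
  obtain ⟨z', hz⟩ := hunc.exists_coord_eq hp (c := fun k => |he.coord z k|) (y := z)
    fun k => (abs_abs _).le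
  have h1 := hunc.supSeminorm_le_two_mul hpi (x := x) (y := y' + z') fun k => by
    rw [coord_add, hy, hz]; exact (h k).trans (le_abs_self _)
  have h2 := hunc.supSeminorm_le_two_mul hpi (x := y') (y := y) fun k => by rw [hy, abs_abs]
  have h3 := hunc.supSeminorm_le_two_mul hpi (x := z') (y := z) fun k => by rw [hz, abs_abs]
  linarith [map_add_le_add (he.supSeminorm (p i)) y' z']

end IsSchauderBasis

/-! ### Superposition with left continuous functions -/

namespace IsSchauderBasis

variable {M E : Type*} [MeasurableSpace M] {μ : Measure M} [AddCommGroup E] [Module ℝ E]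
  [UniformSpace E] [IsUniformAddGroup E] {p : SeminormFamily ℝ E ℕ} {e : ℕ → E}

/-- A function with measurable coordinates that is bounded below is the limit of an increasing
sequence of step functions. -/
theorem Unconditional.exists_monotone_simpleFunc [CompleteSpace E]
    {he : IsSchauderBasis e} (hunc : he.Unconditional) (hp : WithSeminorms p) {u : M → E} {a : E}
    (hu : ∀ k, AEMeasurable (fun t => he.coord (u t) k) μ) (hau : ∀ᵐ t ∂μ, he.CoordLE a (u t)) :
    ∃ s : ℕ → SimpleFunc M E, ∀ᵐ t ∂μ, (∀ n, he.CoordLE (s n t) (s (n + 1) t)) ∧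
      Tendsto (fun n => s n t) atTop (𝓝 (u t)) := by
  have := hp.continuousSMul
  let w : ℕ → M → ENNReal := fun k t => ENNReal.ofReal ((hu k).mk _ t - he.coord a k)
  have hw : ∀ k, Measurable (w k) := fun k =>
    ((hu k).measurable_mk.sub_const _).ennreal_ofReal
  let φ : ℕ → ℕ → SimpleFunc M ℝ := fun n k =>
    (SimpleFunc.eapprox (w k) n).map ENNReal.toReal
  let s : ℕ → SimpleFunc M E := fun n => SimpleFunc.const M a + simpleSum e (φ n) n
  have hcoord : ∀ n t k, he.coord (s n t) k
      = he.coord a k + if k ∈ Finset.range n then φ n k t else 0 := fun n t k => by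
    change he.coord (a + simpleSum e (φ n) n t) k = _
    rw [coord_add, simpleSum_apply]
    congr 1
    exact he.coord_sum_smul _ (fun k => φ n k t) k
  have hφ0 : ∀ n k t, 0 ≤ φ n k t := fun n k t => ENNReal.toReal_nonneg
  have hφmono : ∀ n k t, φ n k t ≤ φ (n + 1) k t := fun n k t =>
    ENNReal.toReal_mono (SimpleFunc.eapprox_lt_top _ _ _).ne
      (SimpleFunc.monotone_eapprox (w k) n.le_succ t)
  have hae : ∀ᵐ t ∂μ, ∀ k, he.coord (u t) k = (hu k).mk _ t :=
    ae_all_iff.2 fun k => (hu k).ae_eq_mk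
  refine ⟨s, ?_⟩
  filter_upwards [hae, hau] with t ht hat
  have hwt : ∀ k, (w k t).toReal = he.coord (u t) k - he.coord a k := fun k => by
    rw [ENNReal.toReal_ofReal (by rw [← ht]; linarith [hat k]), ← ht]
  have hφle : ∀ n k, φ n k t ≤ he.coord (u t) k - he.coord a k := fun n k => by
    rw [← hwt]
    refine ENNReal.toReal_mono ENNReal.ofReal_ne_top ?_
    have := le_iSup (fun n => SimpleFunc.eapprox (w k) n t) n
    rwa [SimpleFunc.iSup_eapprox_apply (hw k)] at this
  refine ⟨fun n k => ?_, ?_⟩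
  · rw [hcoord, hcoord]
    refine add_le_add le_rfl ?_
    split_ifs with h1 h2
    · exact hφmono n k t
    · exact absurd (Finset.mem_range.2 ((Finset.mem_range.1 h1).trans n.lt_succ_self)) h2
    · exact hφ0 _ _ _
    · exact le_rfl
  · obtain ⟨y, hy⟩ := hunc.exists_coord_eq_abs_add_abs hp a (u t)
    have hy' : ∀ k r, he.coord a k ≤ r → r ≤ he.coord (u t) k → |r| ≤ |he.coord y k| := by
      intro k r h1 h2
      rw [hy]
      refine le_trans (abs_le.2 ⟨?_, ?_⟩) (le_abs_self _)
      · linarith [neg_abs_le (he.coord a k), abs_nonneg (he.coord (u t) k)]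
      · linarith [le_abs_self (he.coord (u t) k), abs_nonneg (he.coord a k)]
    refine hunc.tendsto_of_coord hp (y := y) (Eventually.of_forall fun n k => ?_)
      (fun k => hy' k _ (hat k) le_rfl) fun k => ?_
    · have h0 := hat k
      have h1 := hφ0 n k t
      have h2 := hφle n k
      refine hy' k _ ?_ ?_ <;> rw [hcoord] <;> split_ifs <;> linarith
    · have h1 : Tendsto (fun n => φ n k t) atTop (𝓝 (he.coord (u t) k - he.coord a k)) := by
        rw [← hwt]
        exact (ENNReal.tendsto_toReal ENNReal.ofReal_ne_top).comp
          (SimpleFunc.tendsto_eapprox (hw k) t)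
      have h2 := h1.const_add (he.coord a k)
      rw [add_sub_cancel] at h2
      refine h2.congr' ?_
      filter_upwards [eventually_gt_atTop k] with n hn
      rw [hcoord, if_pos (Finset.mem_range.2 hn)]

/-- Left continuity of `f t` makes the superposition `t ↦ f t (u t)` measurable. -/
theorem Unconditional.aemeasurable_comp [CompleteSpace E]
    {he : IsSchauderBasis e} (hunc : he.Unconditional) (hp : WithSeminorms p) {f : M → E → E}
    (hf : ∀ x k, AEMeasurable (fun t => he.coord (f t x) k) μ)
    (hleft : ∀ᵐ t ∂μ, ∀ k, he.LeftContinuous fun x => he.coord (f t x) k) {u : M → E} {a : E}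
    (hu : ∀ k, AEMeasurable (fun t => he.coord (u t) k) μ) (hau : ∀ᵐ t ∂μ, he.CoordLE a (u t))
    (k : ℕ) : AEMeasurable (fun t => he.coord (f t (u t)) k) μ := by
  classical
  obtain ⟨s, hs⟩ := hunc.exists_monotone_simpleFunc hp hu hau
  refine aemeasurable_of_tendsto_metrizable_ae atTop
    (f := fun n t => he.coord (f t (s n t)) k) (fun n => ?_) ?_
  · have h : ∀ t, he.coord (f t (s n t)) k
        = ∑ y ∈ (s n).range, (s n ⁻¹' {y}).indicator (fun t => he.coord (f t y) k) t := fun t => by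
      rw [Finset.sum_eq_single (s n t)]
      · simp
      · intro y _ hy
        exact indicator_of_notMem (fun h => hy h.symm) _
      · intro h; exact absurd ((s n).mem_range_self t) h
    simp only [h]
    exact Finset.aemeasurable_fun_sum _ fun y _ =>
      (hf y k).indicator ((s n).measurableSet_fiber y)
  · filter_upwards [hs, hleft] with t ht hl
    exact hl k (u t) _ ht.2 ht.1

/-- The superposition `t ↦ f t (u t)` is integrable if it lies between the integrable function
`t ↦ f t a` and a constant. -/
theorem Unconditional.frechetIntegrable_comp [T2Space E] [CompleteSpace E] [IsFiniteMeasure μ]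
    {he : IsSchauderBasis e} (hunc : he.Unconditional) (hp : WithSeminorms p) {f : M → E → E}
    (hf : ∀ x, FrechetIntegrable p μ fun t => f t x)
    (hleft : ∀ᵐ t ∂μ, ∀ k, he.LeftContinuous fun x => he.coord (f t x) k) {u : M → E} {a C : E}
    (hu : ∀ k, AEMeasurable (fun t => he.coord (u t) k) μ) (hau : ∀ᵐ t ∂μ, he.CoordLE a (u t))
    (hlow : ∀ᵐ t ∂μ, he.CoordLE (f t a) (f t (u t)))
    (hupp : ∀ᵐ t ∂μ, he.CoordLE (f t (u t)) C) :
    FrechetIntegrable p μ fun t => f t (u t) := by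
  have := hp.continuousSMul
  refine hunc.frechetIntegrable_of_coord hp
    (hunc.aemeasurable_comp hp (fun x k => hunc.aemeasurable_coord hp (hf x) k) hleft hu hau)
    fun i => ?_
  have h1 := hunc.lintegral_supSeminorm_lt_top hp (hf a) i
  calc ∫⁻ t, ENNReal.ofReal (he.supSeminorm (p i) (f t (u t))) ∂μ
      ≤ ∫⁻ t, ENNReal.ofReal 4 * (ENNReal.ofReal (he.supSeminorm (p i) (f t a))
          + ENNReal.ofReal (he.supSeminorm (p i) C)) ∂μ := by
        refine lintegral_mono_ae ?_
        filter_upwards [hlow, hupp] with t hl hC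
        rw [← ENNReal.ofReal_add (apply_nonneg _ _) (apply_nonneg _ _),
          ← ENNReal.ofReal_mul (by norm_num)]
        refine ENNReal.ofReal_le_ofReal (hunc.supSeminorm_le_of_abs_le_add hp i fun k => ?_)
        refine abs_le.2 ⟨?_, ?_⟩
        · linarith [hl k, neg_abs_le (he.coord (f t a) k), abs_nonneg (he.coord C k)]
        · linarith [hC k, le_abs_self (he.coord C k), abs_nonneg (he.coord (f t a) k)]
    _ = ENNReal.ofReal 4 * (∫⁻ t, ENNReal.ofReal (he.supSeminorm (p i) (f t a)) ∂μ
          + ENNReal.ofReal (he.supSeminorm (p i) C) * μ univ) := by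
        rw [lintegral_const_mul' _ _ ENNReal.ofReal_ne_top,
          lintegral_add_right _ measurable_const, lintegral_const]
    _ < ⊤ := ENNReal.mul_lt_top ENNReal.ofReal_lt_top (ENNReal.add_lt_top.2
        ⟨h1, ENNReal.mul_lt_top ENNReal.ofReal_lt_top (measure_lt_top _ _)⟩)

end IsSchauderBasis

end

/-! ### The monotone iteration -/

theorem theorem2p1 {E : Type*} [AddCommGroup E] [Module ℝ E] [UniformSpace E]
    [IsUniformAddGroup E] [CompleteSpace E] [T2Space E]
    (p : SeminormFamily ℝ E ℕ) (hp : WithSeminorms p)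
    (e : ℕ → E) (he : IsSchauderBasis e) (hunc : he.Unconditional)
    (T : ℝ) (hT : 0 < T) (f : ℝ → E → E) (x₀ : E)
    (hleft : ∀ t ∈ Icc 0 T, ∀ k : ℕ, he.LeftContinuous (fun x => he.coord (f t x) k))
    (hint : ∀ x : E, FrechetIntegrable p (volume.restrict (Icc 0 T)) (fun t => f t x))
    (hbound : ∃ C : E, ∀ t ∈ Icc 0 T, ∀ x : E, he.CoordLE (f t x) C)
    (hsub : ∃ xs : E, ∀ t ∈ Icc 0 T, ∃ v : E,
      HasFrechetIntegral p (volume.restrict (Icc 0 t)) (fun ξ => f ξ xs) v ∧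
        he.CoordLE xs (x₀ + v))
    (hmono : ∀ t ∈ Icc 0 T, ∀ x y : E, he.CoordLE x y → he.CoordLE (f t x) (f t y)) :
    ∃ x : ℝ → E, IsIVPSolution p T f x₀ x := by
  obtain ⟨C, hC⟩ := hbound
  obtain ⟨xs, hxs⟩ := hsub
  have := hp.continuousSMul
  have hsubset : ∀ t ∈ Icc 0 T, Icc 0 t ⊆ Icc 0 T := fun t ht => Icc_subset_Icc_right ht.2
  have hmem : ∀ᵐ t ∂volume.restrict (Icc 0 T), t ∈ Icc 0 T := ae_restrict_mem measurableSet_Icc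
  -- functions above `xs` with measurable coordinates
  let Adm : (ℝ → E) → Prop := fun u =>
    (∀ k, AEMeasurable (fun t => he.coord (u t) k) (volume.restrict (Icc 0 T))) ∧
      ∀ t ∈ Icc 0 T, he.CoordLE xs (u t)
  have hFI : ∀ u, Adm u → FrechetIntegrable p (volume.restrict (Icc 0 T)) fun t => f t (u t) :=
    fun u hu => hunc.frechetIntegrable_comp hp hint (hmem.mono hleft) (a := xs) (C := C) hu.1
      (hmem.mono hu.2) (hmem.mono fun t ht => hmono t ht _ _ (hu.2 t ht))
      (hmem.mono fun t ht => hC t ht _)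
  have hI : ∀ u, Adm u → ∀ k, IntegrableOn (fun t => he.coord (f t (u t)) k) (Icc 0 T) :=
    fun u hu k => hunc.integrable_coord hp (hFI u hu) k
  have hFIt : ∀ u, Adm u → ∀ t ∈ Icc 0 T, ∃ v,
      HasFrechetIntegral p (volume.restrict (Icc 0 t)) (fun ξ => f ξ (u ξ)) v := fun u hu t ht => by
    obtain ⟨s, hs⟩ := hFI u hu
    exact he.exists_hasFrechetIntegral hp
      ⟨s, hs.mono (Measure.restrict_mono_set _ (hsubset t ht))⟩
  have hΦ : ∀ u, ∃ w : ℝ → E, Adm u → ∀ t ∈ Icc 0 T, ∀ k,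
      he.coord (w t) k = he.coord x₀ k + ∫ ξ in Icc 0 t, he.coord (f ξ (u ξ)) k := fun u => by
    by_cases hu : Adm u
    · choose! v hv using hFIt u hu
      refine ⟨fun t => x₀ + v t, fun _ t ht k => ?_⟩
      rw [IsSchauderBasis.coord_add, hunc.coord_integral hp (hv t ht)]
    · exact ⟨u, fun h => absurd h hu⟩
  choose Φ hΦ using hΦ
  have hΦmono : ∀ u w, Adm u → Adm w → (∀ t ∈ Icc 0 T, he.CoordLE (u t) (w t)) →
      ∀ t ∈ Icc 0 T, he.CoordLE (Φ u t) (Φ w t) := fun u w hu hw huw t ht k => by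
    rw [hΦ u hu t ht, hΦ w hw t ht]
    refine add_le_add le_rfl (setIntegral_mono_on ((hI u hu k).mono_set (hsubset t ht))
      ((hI w hw k).mono_set (hsubset t ht)) measurableSet_Icc fun ξ hξ => ?_)
    exact hmono ξ (hsubset t ht hξ) _ _ (huw ξ (hsubset t ht hξ)) k
  have hAdm0 : Adm fun _ => xs := ⟨fun k => aemeasurable_const, fun t _ k => le_rfl⟩
  have hstart : ∀ t ∈ Icc 0 T, he.CoordLE xs (Φ (fun _ => xs) t) := fun t ht k => by
    obtain ⟨v, hv, hle⟩ := hxs t ht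
    rw [hΦ _ hAdm0 t ht, ← hunc.coord_integral hp hv, ← IsSchauderBasis.coord_add]
    exact hle k
  have hΦcont : ∀ u, Adm u → ∀ k, ContinuousOn
      (fun t => he.coord x₀ k + ∫ ξ in Icc 0 t, he.coord (f ξ (u ξ)) k) (Icc 0 T) := fun u hu k =>
    continuousOn_const.add (intervalIntegral.continuousOn_primitive_Icc (hI u hu k))
  have hΦAdm : ∀ u, Adm u → Adm (Φ u) := fun u hu =>
    ⟨fun k => ((hΦcont u hu k).congr fun t ht => hΦ u hu t ht k).aemeasurable measurableSet_Icc,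
      fun t ht k => (hstart t ht k).trans (hΦmono _ _ hAdm0 hu hu.2 t ht k)⟩
  let U : ℕ → ℝ → E := fun n => Φ^[n] fun _ => xs
  have hU : ∀ n, U (n + 1) = Φ (U n) := fun n => Function.iterate_succ_apply' _ _ _
  have hUAdm : ∀ n, Adm (U n) := fun n => by
    induction n with
    | zero => exact hAdm0
    | succ n ih => rw [hU]; exact hΦAdm _ ih
  have hUmono : ∀ n, ∀ t ∈ Icc 0 T, he.CoordLE (U n t) (U (n + 1) t) := fun n => by
    induction n with
    | zero => exact hstart
    | succ n ih =>
      rw [hU n, hU (n + 1)]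
      exact hΦmono _ _ (hUAdm n) (hUAdm (n + 1)) ih
  -- all iterates are dominated by one vector, since `f` is bounded above by `C`
  obtain ⟨D₁, hD₁⟩ := hunc.exists_coord_eq_abs_add_abs hp xs x₀
  obtain ⟨D, hD⟩ := hunc.exists_coord_eq_abs_add_abs hp D₁ (T • C)
  have hΦle : ∀ u, Adm u → ∀ t ∈ Icc 0 T, ∀ k,
      he.coord (Φ u t) k ≤ |he.coord x₀ k| + T * |he.coord C k| := fun u hu t ht k => by
    rw [hΦ u hu t ht]
    refine add_le_add (le_abs_self _) ?_
    have h1 : ∫ ξ in Icc 0 t, he.coord (f ξ (u ξ)) k ≤ ∫ _ in Icc 0 t, |he.coord C k| :=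
      setIntegral_mono_on ((hI u hu k).mono_set (hsubset t ht)) (integrableOn_const (by simp))
        measurableSet_Icc fun ξ hξ => (hC ξ (hsubset t ht hξ) _ k).trans (le_abs_self _)
    rw [setIntegral_const, Real.volume_real_Icc_of_le ht.1, smul_eq_mul, sub_zero] at h1
    exact h1.trans (mul_le_mul_of_nonneg_right ht.2 (abs_nonneg _))
  have hdomD : ∀ k r, he.coord xs k ≤ r →
      r ≤ |he.coord xs k| + |he.coord x₀ k| + T * |he.coord C k| → |r| ≤ |he.coord D k| :=
    fun k r h1 h2 => by
      have h3 : he.coord D k = |he.coord xs k| + |he.coord x₀ k| + T * |he.coord C k| := by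
        rw [hD, hD₁, IsSchauderBasis.coord_smul, abs_mul, abs_of_pos hT,
          abs_of_nonneg (add_nonneg (abs_nonneg _) (abs_nonneg _))]
      have h4 : 0 ≤ T * |he.coord C k| := by positivity
      rw [h3]
      refine le_trans (abs_le.2 ⟨?_, h2⟩) (le_abs_self _)
      linarith [neg_abs_le (he.coord xs k), abs_nonneg (he.coord x₀ k)]
  have hUD : ∀ n, ∀ t ∈ Icc 0 T, ∀ k, |he.coord (U n t) k| ≤ |he.coord D k| := fun n t ht k => by
    refine hdomD k _ ((hUAdm n).2 t ht k) ?_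
    refine (hUmono n t ht k).trans ?_
    rw [hU]
    linarith [hΦle _ (hUAdm n) t ht k, abs_nonneg (he.coord xs k)]
  have hlim : ∀ t ∈ Icc 0 T, ∃ x, (∀ k, |he.coord x k| ≤ |he.coord D k|) ∧
      ∀ k, Tendsto (fun n => he.coord (U n t) k) atTop (𝓝 (he.coord x k)) := fun t ht => by
    have h1 : ∀ k, ∃ c, Tendsto (fun n => he.coord (U n t) k) atTop (𝓝 c) := fun k =>
      ⟨_, tendsto_atTop_ciSup (monotone_nat_of_le_succ fun n => hUmono n t ht k)
        ⟨|he.coord D k|, by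
          rintro _ ⟨n, rfl⟩
          exact (le_abs_self _).trans (hUD n t ht k)⟩⟩
    choose c hc using h1
    have h2 : ∀ k, |c k| ≤ |he.coord D k| := fun k =>
      le_of_tendsto (hc k).abs (Eventually.of_forall fun n => hUD n t ht k)
    obtain ⟨x, hx⟩ := hunc.exists_coord_eq hp h2
    exact ⟨x, fun k => by rw [hx]; exact h2 k, fun k => by rw [hx]; exact hc k⟩
  choose! X hXD hX using hlim
  have hXAdm : Adm X :=
    ⟨fun k => aemeasurable_of_tendsto_metrizable_ae atTop (fun n => (hUAdm n).1 k)
        (hmem.mono fun t ht => hX t ht k),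
      fun t ht k => ge_of_tendsto (hX t ht k) (Eventually.of_forall fun n => (hUAdm n).2 t ht k)⟩
  have hfX : ∀ t ∈ Icc 0 T, ∀ k,
      Tendsto (fun n => he.coord (f t (U n t)) k) atTop (𝓝 (he.coord (f t (X t)) k)) :=
    fun t ht k => hleft t ht k (X t) (fun n => U n t)
      (hunc.tendsto_of_coord hp (Eventually.of_forall fun n => hUD n t ht) (hXD t ht) (hX t ht))
      fun n => hUmono n t ht
  have hfix : ∀ t ∈ Icc 0 T, ∀ k,
      he.coord (X t) k = he.coord x₀ k + ∫ ξ in Icc 0 t, he.coord (f ξ (X ξ)) k := fun t ht k => by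
    have hmt : ∀ᵐ ξ ∂volume.restrict (Icc 0 t), ξ ∈ Icc 0 T :=
      (ae_restrict_mem measurableSet_Icc).mono (hsubset t ht)
    refine tendsto_nhds_unique ((tendsto_add_atTop_iff_nat 1).2 (hX t ht k)) ?_
    simp only [hU, hΦ _ (hUAdm _) t ht]
    refine Tendsto.const_add _ (tendsto_integral_of_dominated_convergence
      (fun ξ => |he.coord (f ξ xs) k| + |he.coord C k|)
      (fun n => ((hI _ (hUAdm n) k).mono_set (hsubset t ht)).aestronglyMeasurable) ?_
      (fun n => hmt.mono fun ξ hξ => ?_) (hmt.mono fun ξ hξ => hfX ξ hξ k))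
    · exact (((hI _ hAdm0 k).mono_set (hsubset t ht)).abs).add (integrable_const _)
    · have h1 := hmono ξ hξ _ _ ((hUAdm n).2 ξ hξ) k
      have h2 := hC ξ hξ (U n ξ) k
      refine abs_le.2 ⟨?_, ?_⟩
      · linarith [neg_abs_le (he.coord (f ξ xs) k), abs_nonneg (he.coord C k)]
      · linarith [le_abs_self (he.coord C k), abs_nonneg (he.coord (f ξ xs) k)]
  refine ⟨X, fun t ht => ?_, hFI X hXAdm, fun t ht => ?_⟩
  · refine hunc.tendsto_of_coord hp (eventually_mem_nhdsWithin.mono hXD) (hXD t ht) fun k => ?_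
    exact ((hΦcont X hXAdm k).congr fun t ht => hfix t ht k) t ht
  · obtain ⟨v, hv⟩ := hFIt X hXAdm t ht
    refine ⟨v, hv, he.eq_of_coord_eq fun k => ?_⟩
    rw [hfix t ht, IsSchauderBasis.coord_add, hunc.coord_integral hp hv]
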